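/- Let $0<m<L<\infty$, $n\ge 1$, $N\ge 0$ and $d\ge N+n$. Let $S_{m,L}$ be the set of differentiable $f:\mathbb{R}^d\to\mathbb{R}$ such that $f-\frac m2\|\cdot\|^2$ is convex and $\nabla f$ is $L$-Lipschitz. Let $A_k\in\mathbb{R}^{n\times n}$, $B_k\in\mathbb{R}^{n\times 1}$ ($0\le k<N$) and $C_k\in\mathbb{R}^{1\times n}$ ($0\le k\le N$) define the algorithm $$x_{k+1}=(A_k\otimes I_d)x_k+(B_k\otimes I_d)u_k,\qquad y_k=(C_k\otimes I_d)x_k,\qquad u_k=\nabla f(y_k),\qquad x_0\in\mathbb{R}^{nd}.$$ For $f\in S_{m,L}$ with minimizer $y_*$, an optimal state is an $x_*\in\mathbb{R}^{nd}$ with $x_*=(A_k\otimes I_d)x_*$ for $k<N$ and $y_*=(C_k\otimes I_d)x_*$ for $k\le N$. The worst-case $N$-step performance bound is the smallest $b\in\mathbb{R}$ such that $\|y_N-y_*\|\le b\,\|x_0-x_*\|$ for all $f\in S_{m,L}$, all optimal states $x_*$ of $f$ and all $x_0\in\mathbb{R}^{nd}$ (usually one considers algorithms for which every $f\in S_{m,L}$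 has an optimal state, but this is not needed here). For sequences generated by the algorithm let $\eta=(x_0,u_0,\dots,u_{N-1})$, and let $R_0,R_1,R_{2L},R_{2m}$ be the matrices with $N+n$ columns, built from $(A_k,B_k,C_k)$ and $m,L$ alone, for which, when $x_0$ and the $u_k$ are regarded as free inputs of the linear recursion, $$x_0=(R_0\otimes I_d)\eta,\quad y_N=(R_1\otimes I_d)\eta,\quad (Ly_k-u_k)_{k=0}^{N-1}=(R_{2L}\otimes I_d)\eta,\quad (u_k-my_k)_{k=0}^{N-1}=(R_{2m}\otimes I_d)\eta .$$ Put $M_0(b)=b^2R_0^\top R_0-R_1^\top R_1$. Call $H\in\mathbb{R}^{N\times N}$ doubly hyperdominant if its off-diagonal entries are nonpositive and all its row sums and column sums are nonnegative. Consider the semidefinite program $$\inf\; b\quad\text{over } b\ge 0 \text{ and doubly hyperdominant } H\in\mathbb{R}^{N\times N},\quad\text{subject to}\quad M_0(b)-\begin{bmatrix}R_{2L}\\R_{2m}\end{bmatrix}^\top\begin{bmatrix}0&H\\H^\top&0\end{bmatrix}\begin{bmatrix}R_{2L}\\R_{2m}\end{bmatrix}\succeq 0 .$$ Theorem. The worst-case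 $N$-step performance bound exists and equals the optimal value of this program. Moreover the program attains its optimal value (the infimum is a minimum) whenever the following rank assumption holds: there is $\eta=(\eta_1,\dots,\eta_{N+n})\in(\mathbb{R}^d)^{N+n}$ such that the matrix $[\eta_1,\dots,\eta_{N+n}]\in\mathbb{R}^{d\times(N+n)}$ has rank at least $N+n$ and $\eta^\top(M_P\otimes I_d)\eta\ge 0$ for all $(N+1)\times(N+1)$ permutation matrices $P$, where $$M_P=\frac12\begin{bmatrix}R_{2L}\\R_{2m}\end{bmatrix}^\top\begin{bmatrix}0&Q_P\\Q_P^\top&0\end{bmatrix}\begin{bmatrix}R_{2L}\\R_{2m}\end{bmatrix}$$ and $Q_P$ is $I-P$ with its first row and first column removed. -/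

import Mathlib

open Matrix

noncomputable section

namespace WorstCase

/-- The space `ℝ^d` with its Euclidean norm. -/
abbrev Vec (d : ℕ) : Type := EuclideanSpace ℝ (Fin d)

/-- The state space `ℝ^{nd}`, as `n` stacked blocks of `ℝ^d`, with its Euclidean norm. -/
abbrev State (n d : ℕ) : Type := PiLp 2 (fun _ : Fin n => Vec d)

/-- The class `S_{m,L}`: `f` is `m`-strongly convex with `L`-Lipschitz gradient. -/
structure SmL {d : ℕ} (m L : ℝ) (f : Vec d → ℝ) : Prop where
  convex : ConvexOn ℝ Set.univ (fun y => f y - m / 2 * ‖y‖ ^ 2)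
  differentiable : Differentiable ℝ f
  lipschitz : ∀ y₁ y₂ : Vec d, ‖gradient f y₂ - gradient f y₁‖ ≤ L * ‖y₂ - y₁‖

/-- The data of a linear time-varying first-order algorithm with `n` (block) states. For a horizon
`N` only `A k`, `B k` with `k < N` and `C k` with `k ≤ N` matter. -/
structure Algorithm (n : ℕ) where
  A : ℕ → Matrix (Fin n) (Fin n) ℝ
  B : ℕ → Matrix (Fin n) (Fin 1) ℝ
  C : ℕ → Matrix (Fin 1) (Fin n) ℝ

namespace Algorithm

variable {n : ℕ}

/-- `(A_k ⊗ I_d) x`. -/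
def applyA (alg : Algorithm n) {d : ℕ} (k : ℕ) (x : State n d) : State n d :=
  WithLp.toLp 2 fun i => ∑ j, alg.A k i j • x j

/-- `(B_k ⊗ I_d) u`. -/
def applyB (alg : Algorithm n) {d : ℕ} (k : ℕ) (u : Vec d) : State n d :=
  WithLp.toLp 2 fun i => alg.B k i 0 • u

/-- `(C_k ⊗ I_d) x`. -/
def applyC (alg : Algorithm n) {d : ℕ} (k : ℕ) (x : State n d) : Vec d :=
  ∑ j, alg.C k 0 j • x j

/-- The state `x_k` of the algorithm run on `f` from the initial state `x₀`. -/
def state (alg : Algorithm n) {d : ℕ} (f : Vec d → ℝ) (x₀ : State n d) : ℕ → State n d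
  | 0 => x₀
  | k + 1 => alg.applyA k (alg.state f x₀ k)
      + alg.applyB k (gradient f (alg.applyC k (alg.state f x₀ k)))

/-- The output `y_k` of the algorithm run on `f` from the initial state `x₀`. -/
def output (alg : Algorithm n) {d : ℕ} (f : Vec d → ℝ) (x₀ : State n d) (k : ℕ) : Vec d :=
  alg.applyC k (alg.state f x₀ k)

/-- `xs` is an optimal state over the horizon `N` corresponding to the minimizer `ys`. -/
def IsOptimalState (alg : Algorithm n) {d : ℕ} (N : ℕ) (ys : Vec d) (xs : State n d) : Prop :=
  (∀ k < N, xs = alg.applyA k xs) ∧ ∀ k ≤ N, ys = alg.applyC k xs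

/-- `b` satisfies `‖y_N - y_*‖ ≤ b ‖x_0 - x_*‖` for all `f ∈ S_{m,L}` on `ℝ^d` and all initial
states. -/
def IsBound (alg : Algorithm n) (d N : ℕ) (m L b : ℝ) : Prop :=
  ∀ f : Vec d → ℝ, SmL m L f →
  ∀ ys : Vec d, IsMinOn f Set.univ ys →
  ∀ xs : State n d, alg.IsOptimalState N ys xs →
  ∀ x₀ : State n d, ‖alg.output f x₀ N - ys‖ ≤ b * ‖x₀ - xs‖

/-- The worst-case `N`-step performance bound on `S_{m,L}` (over `ℝ^d`) is `b`. -/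
def IsWorstCaseBound (alg : Algorithm n) (d N : ℕ) (m L b : ℝ) : Prop :=
  IsLeast {b' : ℝ | alg.IsBound d N m L b'} b

/-! Matrices acting on `η = (x_0, u_0, …, u_{N-1})`, whose blocks are indexed by
`Fin n ⊕ Fin N`. -/

/-- `u_k = (inputMat N k ⊗ I_d) η` for `k < N`. -/
def inputMat (_alg : Algorithm n) (N k : ℕ) : Matrix (Fin 1) (Fin n ⊕ Fin N) ℝ :=
  Matrix.fromCols 0 (Matrix.of fun _ (j : Fin N) => if (j : ℕ) = k then 1 else 0)

/-- `x_k = (stateMat N k ⊗ I_d) η` for `k ≤ N`. -/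
def stateMat (alg : Algorithm n) (N : ℕ) : ℕ → Matrix (Fin n) (Fin n ⊕ Fin N) ℝ
  | 0 => Matrix.fromCols 1 0
  | k + 1 => alg.A k * alg.stateMat N k
      + alg.B k * alg.inputMat N k

/-- `y_k = (outputMat N k ⊗ I_d) η` for `k ≤ N`. -/
def outputMat (alg : Algorithm n) (N k : ℕ) : Matrix (Fin 1) (Fin n ⊕ Fin N) ℝ :=
  alg.C k * alg.stateMat N k

/-- `x_0 = (R_0 ⊗ I_d) η`. -/
def R₀ (_alg : Algorithm n) (N : ℕ) : Matrix (Fin n) (Fin n ⊕ Fin N) ℝ :=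
  Matrix.fromCols 1 0

/-- `y_N = (R_1 ⊗ I_d) η`. -/
def R₁ (alg : Algorithm n) (N : ℕ) : Matrix (Fin 1) (Fin n ⊕ Fin N) ℝ :=
  alg.outputMat N N

/-- `Y_{0:N-1} = (Ymat ⊗ I_d) η`. -/
def Ymat (alg : Algorithm n) (N : ℕ) : Matrix (Fin N) (Fin n ⊕ Fin N) ℝ :=
  Matrix.of fun k => alg.outputMat N k 0

/-- `U_{0:N-1} = (Umat ⊗ I_d) η`. -/
def Umat (_alg : Algorithm n) (N : ℕ) : Matrix (Fin N) (Fin n ⊕ Fin N) ℝ :=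
  Matrix.fromCols 0 1

/-- `L Y_{0:N-1} - U_{0:N-1} = (R_{2L} ⊗ I_d) η`. -/
def R2L (alg : Algorithm n) (N : ℕ) (L : ℝ) : Matrix (Fin N) (Fin n ⊕ Fin N) ℝ :=
  L • alg.Ymat N - alg.Umat N

/-- `U_{0:N-1} - m Y_{0:N-1} = (R_{2m} ⊗ I_d) η`. -/
def R2m (alg : Algorithm n) (N : ℕ) (m : ℝ) : Matrix (Fin N) (Fin n ⊕ Fin N) ℝ :=
  alg.Umat N - m • alg.Ymat N

/-- `M_0(b) = b² R_0ᵀ R_0 - R_1ᵀ R_1`. -/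
def M₀ (alg : Algorithm n) (N : ℕ) (b : ℝ) : Matrix (Fin n ⊕ Fin N) (Fin n ⊕ Fin N) ℝ :=
  b ^ 2 • ((alg.R₀ N)ᵀ * alg.R₀ N) - (alg.R₁ N)ᵀ * alg.R₁ N

/-- `[R_{2L}; R_{2m}]ᵀ [0 H; Hᵀ 0] [R_{2L}; R_{2m}]`. -/
def multiplier (alg : Algorithm n) (N : ℕ) (m L : ℝ) (H : Matrix (Fin N) (Fin N) ℝ) :
    Matrix (Fin n ⊕ Fin N) (Fin n ⊕ Fin N) ℝ :=
  (Matrix.fromRows (alg.R2L N L) (alg.R2m N m))ᵀ * Matrix.fromBlocks 0 H Hᵀ 0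
    * Matrix.fromRows (alg.R2L N L) (alg.R2m N m)

end Algorithm

/-- Doubly hyperdominant matrices: nonpositive off-diagonal entries, nonnegative row and column
sums. -/
structure DoublyHyperdominant {N : ℕ} (H : Matrix (Fin N) (Fin N) ℝ) : Prop where
  offDiag : ∀ i j, i ≠ j → H i j ≤ 0
  rowSum : ∀ i, 0 ≤ ∑ j, H i j
  colSum : ∀ j, 0 ≤ ∑ i, H i j

/-- The quadratic form `ηᵀ (M ⊗ I_d) η` of a vector `η` with blocks `η i ∈ ℝ^d`. -/
def quadForm {ι : Type*} [Fintype ι] {d : ℕ} (M : Matrix ι ι ℝ) (η : ι → Vec d) : ℝ :=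
  ∑ i, ∑ j, M i j * inner ℝ (η i) (η j)

/-- `Q = [0; I]ᵀ (I - P) [0; I]` for the permutation matrix `P` of a permutation of the `N + 1`
data points `(0,0), (y_0,u_0), …, (y_{N-1},u_{N-1})`. -/
def Qmat {N : ℕ} (π : Equiv.Perm (Fin (N + 1))) : Matrix (Fin N) (Fin N) ℝ :=
  (1 - Equiv.Perm.permMatrix ℝ π).submatrix Fin.succ Fin.succ

namespace Algorithm

variable {n : ℕ}

/-- The matrix `M_i` of the cyclic monotonicity constraint of a permutation. -/
def cycMat (alg : Algorithm n) (N : ℕ) (m L : ℝ) (π : Equiv.Perm (Fin (N + 1))) :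
    Matrix (Fin n ⊕ Fin N) (Fin n ⊕ Fin N) ℝ :=
  (1 / 2 : ℝ) • alg.multiplier N m L (Qmat π)

/-- The rank assumption: some `η` satisfies all the `(N+1)!` cyclic monotonicity constraints, and
the `d × (N+n)` matrix whose columns are its blocks has rank at least `N + n`. -/
def RankAssumption (alg : Algorithm n) (d N : ℕ) (m L : ℝ) : Prop :=
  ∃ η : Fin n ⊕ Fin N → Vec d,
    (∀ π : Equiv.Perm (Fin (N + 1)), 0 ≤ quadForm (alg.cycMat N m L π) η) ∧
    N + n ≤ (Matrix.of fun (a : Fin d) (i : Fin n ⊕ Fin N) => η i a).rank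

/-- The values `b ≥ 0` for which some doubly hyperdominant `H` makes `(b, H)` feasible for the
semidefinite program. -/
def sdpFeasible (alg : Algorithm n) (N : ℕ) (m L : ℝ) : Set ℝ :=
  {b : ℝ | 0 ≤ b ∧ ∃ H : Matrix (Fin N) (Fin N) ℝ, DoublyHyperdominant H ∧
    (alg.M₀ N b - alg.multiplier N m L H).PosSemidef}

end Algorithm

end WorstCase

end

/-!
The theorem is strong duality for the worst-case problem, which becomes a semidefinite problem once
the function `f` is eliminated by an interpolation theorem.

Write `w = L y - u` and `h = u - m y` for data `(y, u)`, with the minimizer contributing `(0, 0)`.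
A finite set of data consists of points and gradients of some `f ∈ S_{m,L}` if and only if there is
a potential `F` with `⟪w_i, h_j - h_i⟫ ≤ F_j - F_i` for all `i, j`. Necessity is
`SmoothStrong.interpolation`; for sufficiency, `exists_smL_interpolant` builds `f` as a conjugate
function. By linear programming duality the potential exists if and only if
`∑ H_ij ⟪w_i, h_j⟫ ≥ 0` for all doubly hyperdominant `H`
(`DoublyHyperdominant.sum_inner_nonneg`, `exists_potential_of_forall_doublyHyperdominant`). The sum
is half the quadratic form of `multiplier H` at `η`, so `b ≥ 0` is a performance bound if and only
if `M₀ b` has nonnegative quadratic form at all `η` at which every multiplier has one.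

A feasible pair `(b, H)` therefore gives a bound (`isBound_of_mem_sdpFeasible`). Conversely, since
`d ≥ N + n`, every positive semidefinite matrix is a Gram matrix of blocks in `ℝ^d`, and separation
of cones shows that for a bound `b` the matrix `M₀ b` lies in the closure of the cone
`{multiplier H + S}` with `H` doubly hyperdominant and `S` positive semidefinite
(`mem_closure_of_forall_quadForm_nonneg`). A coercive multiplier turns points of the closure into
feasible points at an arbitrarily small increase of `b` (`exists_mem_sdpFeasible_le`), so the
optimal value is the worst-case bound. Under the rank assumption the cone is closed
(`isClosed_map_certificateCone`), since there `multiplier H + S = 0` only for `H = 0` and `S = 0`,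
and the optimal value is attained. Birkhoff's theorem (`DoublyHyperdominant.exists_eq_sum_Qmat`) relates
the permutations in the rank assumption to doubly hyperdominant matrices.
-/

open Matrix

noncomputable section

namespace WorstCase

/-! ### Strong convexity and smoothness -/

section Analysis

variable {E : Type*} [NormedAddCommGroup E] [InnerProductSpace ℝ E]

/-- `f` lies between the two paraboloids of curvature `m` and `L` that touch it at each point with
slope `g`. This is the form in which membership in `S_{m,L}` (with `g = ∇f`) is used and
established; see `SmL.smoothStrong` and `SmoothStrong.smL`. -/
def SmoothStrong (m L : ℝ) (f : E → ℝ) (g : E → E) : Prop :=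
  ∀ y z : E, m / 2 * ‖z - y‖ ^ 2 ≤ f z - f y - inner ℝ (g y) (z - y) ∧
    f z - f y - inner ℝ (g y) (z - y) ≤ L / 2 * ‖z - y‖ ^ 2

/-- With `w = L (y - s) - g y` and `h = g y - m (y - s)`, the function `F` on the right satisfies
`⟪w a, h b - h a⟫ ≤ F b - F a`, i.e. the pairs `(h, w)` are cyclically monotone. Up to scaling, `F`
is the conjugate of `f - m/2 ‖· - s‖²` minus a quadratic. The inequality follows by comparing the
lower paraboloid at `b` with the upper paraboloid at `a` in the point
`a + (h b - h a) / (L - m)`. -/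
theorem SmoothStrong.interpolation {m L : ℝ} (hmL : m < L) {f : E → ℝ} {g : E → E}
    (hf : SmoothStrong m L f g) (s a b : E) :
    inner ℝ (L • (a - s) - g a) ((g b - m • (b - s)) - (g a - m • (a - s))) ≤
      ((L - m) * (inner ℝ (g b - m • (b - s)) (b - s) - (f b - m / 2 * ‖b - s‖ ^ 2))
        - ‖g b - m • (b - s)‖ ^ 2 / 2) -
      ((L - m) * (inner ℝ (g a - m • (a - s)) (a - s) - (f a - m / 2 * ‖a - s‖ ^ 2))
        - ‖g a - m • (a - s)‖ ^ 2 / 2) := by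
  have hM : 0 < L - m := sub_pos.2 hmL
  obtain ⟨v, hv⟩ : ∃ v : E, (L - m) • v = (g b - m • (b - s)) - (g a - m • (a - s)) :=
    ⟨(L - m)⁻¹ • _, smul_inv_smul₀ hM.ne' _⟩
  have h1 := (hf b (a + v)).1
  have h2 := (hf a (a + v)).2
  have hgb : g b = (L - m) • v + m • (b - s) + (g a - m • (a - s)) := by rw [hv]; abel
  obtain ⟨p, rfl⟩ : ∃ p, a = p + s := ⟨a - s, by simp⟩
  obtain ⟨q, rfl⟩ : ∃ q, b = q + s := ⟨b - s, by simp⟩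
  -- After translating by `s`, both paraboloids are evaluated at `p + s + v`.
  have e1 : p + s + v - (q + s) = p + v - q := by abel
  rw [e1] at h1
  rw [hgb] at h1 ⊢
  simp only [add_sub_cancel_right, add_sub_cancel_left, ← real_inner_self_eq_norm_sq,
    inner_add_left, inner_add_right, inner_sub_left, inner_sub_right, inner_smul_left,
    inner_smul_right, conj_trivial] at h1 h2 ⊢
  simp only [real_inner_comm v p, real_inner_comm q p, real_inner_comm q v,
    real_inner_comm (g (p + s)) p, real_inner_comm (g (p + s)) q,
    real_inner_comm (g (p + s)) v] at h1 h2 ⊢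
  have := mul_le_mul_of_nonneg_left (sub_nonneg.2 h1) hM.le
  nlinarith [mul_nonneg hM.le (sub_nonneg.2 h1), mul_nonneg hM.le (sub_nonneg.2 h2)]

/-- The two interpolation inequalities for `(a, b)` and `(b, a)` add up to cocoercivity of `g`. -/
theorem SmoothStrong.norm_sub_le {m L : ℝ} (hm : 0 ≤ m) (hmL : m < L) {f : E → ℝ} {g : E → E}
    (hf : SmoothStrong m L f g) (a b : E) : ‖g b - g a‖ ≤ L * ‖b - a‖ := by
  have hf0 : SmoothStrong 0 L f g := fun y z =>
    ⟨by have := (hf y z).1; nlinarith [mul_nonneg hm (sq_nonneg ‖z - y‖)], (hf y z).2⟩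
  have hL : 0 < L := hm.trans_lt hmL
  have h1 := hf0.interpolation hL 0 a b
  have h2 := hf0.interpolation hL 0 b a
  have h3 : ‖g b - g a‖ ^ 2 ≤ L * inner ℝ (b - a) (g b - g a) := by
    simp only [← real_inner_self_eq_norm_sq, inner_sub_left, inner_sub_right, inner_smul_left,
      conj_trivial, zero_smul, sub_zero] at h1 h2 ⊢
    simp only [real_inner_comm (g b) (g a)] at h1 h2 ⊢
    linarith
  have h4 := real_inner_le_norm (b - a) (g b - g a)
  by_contra! hc
  have hpos : 0 < ‖g b - g a‖ := lt_of_le_of_lt (by positivity) hc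
  nlinarith [mul_le_mul_of_nonneg_left h4 hL.le, mul_lt_mul_of_pos_right hc hpos]

theorem SmoothStrong.hasGradientAt [CompleteSpace E] {m L : ℝ} (hm : 0 ≤ m) {f : E → ℝ} {g : E → E}
    (hf : SmoothStrong m L f g) (y : E) : HasGradientAt f (g y) y := by
  rw [hasGradientAt_iff_isLittleO]
  have hO : (fun z => f z - f y - inner ℝ (g y) (z - y)) =O[nhds y] fun z => ‖z - y‖ ^ 2 := by
    refine Asymptotics.IsBigO.of_bound (L / 2) (Filter.Eventually.of_forall fun z => ?_)
    have h1 := (hf y z).1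
    have h2 := (hf y z).2
    rw [Real.norm_eq_abs, abs_of_nonneg (le_trans (by positivity) h1), norm_pow, norm_norm]
    exact h2
  refine hO.trans_isLittleO ?_
  have h0 : (fun z : E => ‖z - y‖) =o[nhds y] fun _ => (1 : ℝ) := by
    rw [Asymptotics.isLittleO_one_iff]
    have : Continuous fun z : E => ‖z - y‖ := by fun_prop
    simpa using this.tendsto y
  have := h0.mul_isBigO (Asymptotics.isBigO_refl (fun z : E => ‖z - y‖) (nhds y))
  simpa [pow_two] using this.norm_right

theorem SmoothStrong.convexOn {m L : ℝ} {f : E → ℝ} {g : E → E}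
    (hf : SmoothStrong m L f g) :
    ConvexOn ℝ Set.univ (fun y => f y - m / 2 * ‖y‖ ^ 2) := by
  refine ⟨convex_univ, fun x _ z _ a b ha hb hab => ?_⟩
  set y := a • x + b • z with hy
  have h1 := (hf y x).1
  have h2 := (hf y z).1
  have e1 : x - y = b • (x - z) := by
    rw [hy]; obtain rfl : a = 1 - b := by linarith
    module
  have e2 : z - y = - a • (x - z) := by
    rw [hy]; obtain rfl : a = 1 - b := by linarith
    module
  have e3 : ‖y‖ ^ 2 = a * ‖x‖ ^ 2 + b * ‖z‖ ^ 2 - a * b * ‖x - z‖ ^ 2 := by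
    rw [hy]; obtain rfl : a = 1 - b := by linarith
    simp only [← real_inner_self_eq_norm_sq, inner_add_left, inner_add_right, inner_sub_left,
      inner_sub_right, inner_smul_left, inner_smul_right, conj_trivial]
    rw [real_inner_comm z x]; ring
  rw [e1, inner_smul_right, norm_smul, mul_pow, Real.norm_eq_abs, sq_abs] at h1
  rw [e2, inner_smul_right, norm_smul, mul_pow, Real.norm_eq_abs, sq_abs] at h2
  simp only [smul_eq_mul]
  rw [e3]
  have := add_le_add (mul_le_mul_of_nonneg_left h1 ha) (mul_le_mul_of_nonneg_left h2 hb)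
  obtain rfl : a = 1 - b := by linarith
  nlinarith

end Analysis

theorem SmoothStrong.smL {d : ℕ} {m L : ℝ} (hm : 0 ≤ m) (hmL : m < L) {f : Vec d → ℝ}
    {g : Vec d → Vec d} (hf : SmoothStrong m L f g) : SmL m L f := by
  have hg : gradient f = g := gradient_eq fun y => hf.hasGradientAt hm y
  refine ⟨hf.convexOn, fun y => (hf.hasGradientAt hm y).differentiableAt, fun a b => ?_⟩
  rw [hg]
  exact hf.norm_sub_le hm hmL a b

theorem SmL.smoothStrong {d : ℕ} {m L : ℝ} {f : Vec d → ℝ}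
    (hf : SmL m L f) : SmoothStrong m L f (gradient f) := by
  intro y z
  have hline : ∀ t : ℝ, HasDerivAt (fun t : ℝ => y + t • (z - y)) (z - y) t := fun t => by
    simpa using ((hasDerivAt_id t).smul_const (z - y)).const_add y
  have hd : ∀ t : ℝ, HasDerivAt (fun t : ℝ => f (y + t • (z - y)))
      (inner ℝ (gradient f (y + t • (z - y))) (z - y)) t := fun t => by
    have h1 := (hf.differentiable (y + t • (z - y))).hasGradientAt.hasFDerivAt
    have h2 := h1.comp_hasDerivAt t (hline t)
    rwa [InnerProductSpace.toDual_apply_apply] at h2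
  constructor
  · have hc : ConvexOn ℝ Set.univ
        (fun t : ℝ => f (y + t • (z - y)) - m / 2 * ‖y + t • (z - y)‖ ^ 2) := by
      have := hf.convex.comp_affineMap (AffineMap.lineMap y z : ℝ →ᵃ[ℝ] Vec d)
      refine this.congr fun t _ => ?_
      simp [AffineMap.lineMap_apply, add_comm]
    have hq : ∀ t : ℝ, ‖y + t • (z - y)‖ ^ 2
        = ‖y‖ ^ 2 + t * (2 * inner ℝ y (z - y)) + t ^ 2 * ‖z - y‖ ^ 2 := fun t => by
      rw [norm_add_sq_real, norm_smul, inner_smul_right, mul_pow, Real.norm_eq_abs, sq_abs]; ring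
    have hder : HasDerivAt (fun t : ℝ => f (y + t • (z - y)) - m / 2 * ‖y + t • (z - y)‖ ^ 2)
        (inner ℝ (gradient f y) (z - y) - m / 2 * (2 * inner ℝ y (z - y))) 0 := by
      simp only [hq]
      have h0 := hd 0
      simp only [zero_smul, add_zero] at h0
      refine h0.sub (HasDerivAt.const_mul _ ?_)
      have h2 := ((hasDerivAt_id (0 : ℝ)).mul_const (2 * inner ℝ y (z - y))).const_add (‖y‖ ^ 2)
      have h3 := ((hasDerivAt_id (0 : ℝ)).pow 2).mul_const (‖z - y‖ ^ 2)
      refine (h2.add h3).congr_deriv ?_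
      simp
    have := hc.le_slope_of_hasDerivAt (Set.mem_univ 0) (Set.mem_univ 1) one_pos hder
    rw [slope_def_field, sub_zero, div_one] at this
    have h1 := hq 1
    simp only [one_smul, add_sub_cancel, zero_smul, add_zero] at this h1
    rw [h1] at this
    linarith
  · have hder : ∀ t : ℝ, HasDerivAt (fun t : ℝ => f (y + t • (z - y))
          - t * inner ℝ (gradient f y) (z - y) - t ^ 2 * (L / 2 * ‖z - y‖ ^ 2))
        (inner ℝ (gradient f (y + t • (z - y))) (z - y) - inner ℝ (gradient f y) (z - y)
          - t * (L * ‖z - y‖ ^ 2)) t := fun t => by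
      have h2 := (hasDerivAt_id t).mul_const (inner ℝ (gradient f y) (z - y))
      have h3 := ((hasDerivAt_id t).pow 2).mul_const (L / 2 * ‖z - y‖ ^ 2)
      refine (((hd t).sub h2).sub h3).congr_deriv ?_
      simp
      ring
    have hanti := antitoneOn_of_deriv_nonpos (convex_Icc (0 : ℝ) 1)
      (fun t _ => (hder t).continuousAt.continuousWithinAt)
      (fun t _ => (hder t).differentiableAt.differentiableWithinAt) (fun t ht => by
        rw [interior_Icc] at ht
        rw [(hder t).deriv]
        have hl := hf.lipschitz y (y + t • (z - y))
        rw [add_sub_cancel_left, norm_smul, Real.norm_eq_abs, abs_of_pos ht.1] at hl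
        have hi := real_inner_le_norm (gradient f (y + t • (z - y)) - gradient f y) (z - y)
        rw [inner_sub_left] at hi
        nlinarith [mul_le_mul_of_nonneg_right hl (norm_nonneg (z - y))])
    have := hanti (Set.left_mem_Icc.2 zero_le_one) (Set.right_mem_Icc.2 zero_le_one) zero_le_one
    simp only [one_smul, add_sub_cancel, zero_smul, add_zero] at this
    linarith

/-! ### Interpolation by functions in `S_{m,L}` -/

section Conjugate

variable {E : Type*} [NormedAddCommGroup E] [InnerProductSpace ℝ E]

/-- A continuous function with an affine minorant attains its minimum after adding `‖·‖² / 2`. -/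
theorem exists_minimizer_add_half_sq [FiniteDimensional ℝ E] {P : E → ℝ} (hP : Continuous P)
    {c : ℝ} {w : E} (hw : ∀ h, c + inner ℝ w h ≤ P h) (p : E) :
    ∃ h₀, ∀ h, P h₀ + ‖h₀‖ ^ 2 / 2 - inner ℝ h₀ p ≤ P h + ‖h‖ ^ 2 / 2 - inner ℝ h p := by
  have : ProperSpace E := FiniteDimensional.proper ℝ E
  refine Continuous.exists_forall_le (f := fun h => P h + ‖h‖ ^ 2 / 2 - inner ℝ h p)
    (by fun_prop) ?_
  have hlow : ∀ h, c - ‖w - p‖ ^ 2 + ‖h‖ * (‖h‖ * (1 / 4)) ≤ P h + ‖h‖ ^ 2 / 2 - inner ℝ h p := by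
    intro h
    have h1 := hw h
    have h2 := real_inner_le_norm (p - w) h
    rw [inner_sub_left, real_inner_comm h p, norm_sub_rev] at h2
    nlinarith [sq_nonneg (‖w - p‖ - ‖h‖ / 2)]
  refine Filter.tendsto_atTop_mono hlow (Filter.tendsto_atTop_add_const_left _ _ ?_)
  have hn := tendsto_norm_cocompact_atTop (E := E)
  exact hn.atTop_mul_atTop₀ (hn.atTop_mul_const (by norm_num))

/-- Quadratic growth of a `1`-strongly convex function away from its minimizer. -/
theorem half_sq_le_of_minimizer {P : E → ℝ} (hP : ConvexOn ℝ Set.univ P) {p h₀ : E}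
    (hmin : ∀ h, P h₀ + ‖h₀‖ ^ 2 / 2 - inner ℝ h₀ p ≤ P h + ‖h‖ ^ 2 / 2 - inner ℝ h p) (h : E) :
    P h₀ + ‖h₀‖ ^ 2 / 2 - inner ℝ h₀ p + ‖h - h₀‖ ^ 2 / 2
      ≤ P h + ‖h‖ ^ 2 / 2 - inner ℝ h p := by
  -- Strong convexity on the segment from `h₀` to `h`, divided by `t`; then `t → 0`.
  have key : ∀ t : ℝ, 0 < t → t ≤ 1 →
      P h₀ + ‖h₀‖ ^ 2 / 2 - inner ℝ h₀ p + (1 - t) * ‖h - h₀‖ ^ 2 / 2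
        ≤ P h + ‖h‖ ^ 2 / 2 - inner ℝ h p := by
    intro t ht ht1
    have h1 := hmin ((1 - t) • h₀ + t • h)
    have h2 := hP.2 (Set.mem_univ h₀) (Set.mem_univ h) (sub_nonneg.2 ht1) ht.le (by ring)
    simp only [smul_eq_mul] at h2
    have e3 : ‖(1 - t) • h₀ + t • h‖ ^ 2
        = (1 - t) * ‖h₀‖ ^ 2 + t * ‖h‖ ^ 2 - (1 - t) * t * ‖h - h₀‖ ^ 2 := by
      simp only [← real_inner_self_eq_norm_sq, inner_add_left, inner_add_right, inner_sub_left,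
        inner_sub_right, inner_smul_left, inner_smul_right, conj_trivial]
      rw [real_inner_comm h h₀]; ring
    rw [e3, inner_add_left, inner_smul_left, inner_smul_left] at h1
    simp only [conj_trivial] at h1
    refine le_of_mul_le_mul_left ?_ ht
    linarith
  refine le_of_forall_pos_le_add fun ε hε => ?_
  have hD : 0 < ‖h - h₀‖ ^ 2 + 1 := by positivity
  have hmin' : 0 < min 1 (ε / (‖h - h₀‖ ^ 2 + 1)) := lt_min one_pos (by positivity)
  have h1 := key _ hmin' (min_le_left _ _)
  have h2 : min 1 (ε / (‖h - h₀‖ ^ 2 + 1)) * (‖h - h₀‖ ^ 2 + 1) ≤ ε :=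
    (mul_le_mul_of_nonneg_right (min_le_right _ _) hD.le).trans_eq (div_mul_cancel₀ _ hD.ne')
  nlinarith

/-- The conjugate `ψ` of `P + ‖·‖² / 2` is convex and `1`-smooth; its gradient at `p` is the
maximizer `h₀` of `⟪·, p⟫ - P - ‖·‖² / 2`, recognised by `p - h₀` being a subgradient of `P`. -/
theorem exists_smoothStrong_conjugate [FiniteDimensional ℝ E] {P : E → ℝ}
    (hP : ConvexOn ℝ Set.univ P) (hc : Continuous P)
    {c : ℝ} {w : E} (hw : ∀ h, c + inner ℝ w h ≤ P h) :
    ∃ (ψ : E → ℝ) (g : E → E), SmoothStrong 0 1 ψ g ∧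
      ∀ p h₀, (∀ h, P h₀ + inner ℝ (p - h₀) (h - h₀) ≤ P h) → g p = h₀ := by
  choose g hg using exists_minimizer_add_half_sq hc hw
  refine ⟨fun p => inner ℝ (g p) p - P (g p) - ‖g p‖ ^ 2 / 2, g, fun p z => ⟨?_, ?_⟩, ?_⟩
  · have := hg z (g p)
    rw [inner_sub_right]
    linarith
  · have h1 := half_sq_le_of_minimizer hP (hg p) (g z)
    have h2 := real_inner_le_norm (g z - g p) (z - p)
    rw [inner_sub_left, inner_sub_right, inner_sub_right] at h2
    rw [inner_sub_right]
    nlinarith [sq_nonneg (‖g z - g p‖ - ‖z - p‖)]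
  · intro p h₀ h
    have h1 := half_sq_le_of_minimizer hP (hg p) h₀
    have h2 := h (g p)
    have h3 : ‖g p - h₀‖ ^ 2 = ‖g p‖ ^ 2 - 2 * inner ℝ (g p) h₀ + ‖h₀‖ ^ 2 := norm_sub_sq_real _ _
    have h4 := norm_sub_rev h₀ (g p)
    rw [h4] at h1
    simp only [inner_sub_left, inner_sub_right, real_inner_self_eq_norm_sq] at h2
    rw [real_inner_comm (g p) p, real_inner_comm h₀ p, real_inner_comm (g p) h₀] at h2
    have h5 : ‖g p - h₀‖ ^ 2 ≤ 0 := by linarith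
    have h6 : ‖g p - h₀‖ = 0 := by nlinarith [norm_nonneg (g p - h₀)]
    exact sub_eq_zero.1 (norm_eq_zero.1 h6)

/-- Rescaling turns a convex `1`-smooth function into an `m`-strongly convex, `L`-smooth one. -/
theorem SmoothStrong.rescale {m L : ℝ} (hmL : m < L) {ψ : E → ℝ} {g : E → E}
    (hψ : SmoothStrong 0 1 ψ g) :
    SmoothStrong m L (fun y => (L - m)⁻¹ * ψ ((L - m) • y) + m / 2 * ‖y‖ ^ 2)
      (fun y => g ((L - m) • y) + m • y) := by
  have hM : 0 < L - m := sub_pos.2 hmL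
  intro y z
  obtain ⟨h1, h2⟩ := hψ ((L - m) • y) ((L - m) • z)
  rw [← smul_sub, inner_smul_right, norm_smul, mul_pow, Real.norm_eq_abs, sq_abs] at h1 h2
  have h3 : ‖z‖ ^ 2 - ‖y‖ ^ 2 - 2 * inner ℝ y (z - y) = ‖z - y‖ ^ 2 := by
    rw [norm_sub_sq_real, inner_sub_right, real_inner_self_eq_norm_sq, real_inner_comm y z]; ring
  have e : ((L - m)⁻¹ * ψ ((L - m) • z) + m / 2 * ‖z‖ ^ 2)
      - ((L - m)⁻¹ * ψ ((L - m) • y) + m / 2 * ‖y‖ ^ 2)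
      - inner ℝ (g ((L - m) • y) + m • y) (z - y)
      = (L - m)⁻¹ * (ψ ((L - m) • z) - ψ ((L - m) • y)
          - (L - m) * inner ℝ (g ((L - m) • y)) (z - y)) + m / 2 * ‖z - y‖ ^ 2 := by
    rw [inner_add_left, inner_smul_left, ← h3, conj_trivial]
    field_simp
    ring
  simp only [e]
  constructor
  · have := mul_le_mul_of_nonneg_left h1 (inv_pos.2 hM).le
    simp only [zero_div, zero_mul, mul_zero] at this
    linarith
  · have := mul_le_mul_of_nonneg_left h2 (inv_pos.2 hM).le
    have e2 : (L - m)⁻¹ * (1 / 2 * ((L - m) ^ 2 * ‖z - y‖ ^ 2)) = (L - m) / 2 * ‖z - y‖ ^ 2 := by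
      field_simp
    linarith

end Conjugate

/-- Interpolation: data `(y_i, u_i)` whose transforms `h_i = u_i - m y_i` and `w_i = L y_i - u_i`
admit a potential are the points and gradients of some `f ∈ S_{m,L}`. The function `f` is the
rescaled conjugate of `P + ‖·‖² / 2` with `P` the largest of the affine functions
`F_i + ⟪w_i, · - h_i⟫`. -/
theorem exists_smL_interpolant {d : ℕ} {κ : Type*} [Fintype κ] [Nonempty κ] {m L : ℝ}
    (hm : 0 ≤ m) (hmL : m < L) (y u : κ → Vec d) (F : κ → ℝ)
    (hF : ∀ i j, inner ℝ (L • y i - u i) ((u j - m • y j) - (u i - m • y i)) ≤ F j - F i) :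
    ∃ f : Vec d → ℝ, SmL m L f ∧ ∀ i, gradient f (y i) = u i := by
  let P : Vec d → ℝ := fun h => Finset.univ.sup' Finset.univ_nonempty
    fun i => F i + inner ℝ (L • y i - u i) (h - (u i - m • y i))
  have hle : ∀ i h, F i + inner ℝ (L • y i - u i) (h - (u i - m • y i)) ≤ P h := fun i h =>
    Finset.le_sup' (fun i => F i + inner ℝ (L • y i - u i) (h - (u i - m • y i)))
      (Finset.mem_univ i)
  have hP : ConvexOn ℝ Set.univ P := by
    refine ⟨convex_univ, fun x _ z _ a b ha hb hab => Finset.sup'_le _ _ fun i _ => ?_⟩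
    have h1 := mul_le_mul_of_nonneg_left (hle i x) ha
    have h2 := mul_le_mul_of_nonneg_left (hle i z) hb
    have e : F i + inner ℝ (L • y i - u i) (a • x + b • z - (u i - m • y i))
        = a * (F i + inner ℝ (L • y i - u i) (x - (u i - m • y i)))
          + b * (F i + inner ℝ (L • y i - u i) (z - (u i - m • y i))) := by
      obtain rfl : a = 1 - b := by linarith
      rw [inner_sub_right _ x, inner_sub_right _ z, inner_sub_right, inner_add_right,
        inner_smul_right, inner_smul_right]
      ring
    simp only [smul_eq_mul]
    linarith
  have hc : Continuous P := by
    refine Continuous.finset_sup'_apply _ fun i _ => ?_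
    fun_prop
  obtain ⟨i₀⟩ := ‹Nonempty κ›
  obtain ⟨ψ, g, hψ, hg⟩ := exists_smoothStrong_conjugate hP hc
    (c := F i₀ - inner ℝ (L • y i₀ - u i₀) (u i₀ - m • y i₀)) (w := L • y i₀ - u i₀) (fun h => by
      have := hle i₀ h
      rw [inner_sub_right] at this
      linarith)
  have hs := hψ.rescale hmL
  refine ⟨_, hs.smL hm hmL, fun i => ?_⟩
  rw [(hs.hasGradientAt hm (y i)).gradient]
  have : g ((L - m) • y i) = u i - m • y i := by
    refine hg _ _ fun h => ?_
    have e : (L - m) • y i - (u i - m • y i) = L • y i - u i := by module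
    rw [e]
    refine le_trans ?_ (hle i h)
    gcongr
    refine Finset.sup'_le _ _ fun j _ => ?_
    linarith [hF j i]
  rw [this]
  abel

/-! ### Closed cones and Farkas' lemma -/

section Cones

/-- The image of a closed cone under a linear map is closed if the kernel meets the cone only
at `0`. -/
theorem isClosed_map_of_forall_eq_zero {E F : Type*} [NormedAddCommGroup E] [NormedSpace ℝ E]
    [FiniteDimensional ℝ E] [NormedAddCommGroup F] [NormedSpace ℝ F] (T : E →ₗ[ℝ] F)
    {K : Set E} (hK : IsClosed K) (hsmul : ∀ x ∈ K, ∀ t : ℝ, 0 ≤ t → t • x ∈ K)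
    (hker : ∀ x ∈ K, T x = 0 → x = 0) : IsClosed (T '' K) := by
  have : ProperSpace E := FiniteDimensional.proper ℝ E
  have hT : Continuous T := T.continuous_of_finiteDimensional
  obtain ⟨c, hc, hcK⟩ : ∃ c > 0, ∀ x ∈ K, c * ‖x‖ ≤ ‖T x‖ := by
    -- On the unit sphere of `K` the norm of `T x` has a positive minimum.
    have hcomp : IsCompact (K ∩ Metric.sphere 0 1) := (isCompact_sphere 0 1).inter_left hK
    have hcont : ContinuousOn (fun x => ‖T x‖) (K ∩ Metric.sphere 0 1) := hT.norm.continuousOn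
    obtain ⟨c, hc, hle⟩ : ∃ c > 0, ∀ x ∈ K ∩ Metric.sphere 0 1, c ≤ ‖T x‖ := by
      rcases (K ∩ Metric.sphere (0 : E) 1).eq_empty_or_nonempty with he | hne
      · exact ⟨1, one_pos, by simp [he]⟩
      · obtain ⟨x, hx, hmin⟩ := hcomp.exists_isMinOn hne hcont
        refine ⟨‖T x‖, norm_pos_iff.2 fun h => ?_, fun z hz => hmin hz⟩
        have := hker x hx.1 h
        simp [this] at hx
    refine ⟨c, hc, fun x hx => ?_⟩
    rcases eq_or_ne x 0 with rfl | hx0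
    · simp
    · have hpos : 0 < ‖x‖ := norm_pos_iff.2 hx0
      have := hle (‖x‖⁻¹ • x) ⟨hsmul x hx _ (inv_pos.2 hpos).le, by
        simp [norm_smul, hpos.ne']⟩
      rw [map_smul, norm_smul, norm_inv, norm_norm] at this
      rwa [← div_eq_inv_mul, le_div_iff₀ hpos] at this
  refine isClosed_of_closure_subset fun y hy => ?_
  -- Near `y`, only points of `K` in a fixed ball are mapped by `T`, so compactness applies.
  have hcomp : IsCompact (T '' (K ∩ Metric.closedBall 0 ((‖y‖ + 1) / c))) :=
    ((isCompact_closedBall 0 _).inter_left hK).image hT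
  have hmem : y ∈ closure (T '' (K ∩ Metric.closedBall 0 ((‖y‖ + 1) / c))) := by
    rw [Metric.mem_closure_iff] at hy ⊢
    intro ε hε
    obtain ⟨_, ⟨x, hx, rfl⟩, hd⟩ := hy (min ε 1) (lt_min hε one_pos)
    refine ⟨T x, ⟨x, ⟨hx, ?_⟩, rfl⟩, hd.trans_le (min_le_left _ _)⟩
    rw [mem_closedBall_zero_iff, le_div_iff₀ hc, mul_comm]
    refine (hcK x hx).trans ?_
    have h1 : dist y (T x) < 1 := hd.trans_le (min_le_right _ _)
    rw [dist_comm, dist_eq_norm] at h1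
    linarith [norm_sub_norm_le (T x) y]
  rw [hcomp.isClosed.closure_eq] at hmem
  exact Set.image_mono Set.inter_subset_left hmem

/-- Farkas' lemma in coordinates. -/
theorem exists_sum_mul_neg_of_notMem_closure {κ : Type*} [Fintype κ] {C : PointedCone ℝ (κ → ℝ)}
    {x : κ → ℝ} (hx : x ∉ closure (C : Set (κ → ℝ))) :
    ∃ l : κ → ℝ, (∀ c ∈ C, 0 ≤ ∑ k, l k * c k) ∧ ∑ k, l k * x k < 0 := by
  classical
  have hcl : ∀ z, z ∈ (⟨C.topologicalClosure, C.isClosed_topologicalClosure⟩ : ProperCone ℝ (κ → ℝ))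
      ↔ z ∈ closure (C : Set (κ → ℝ)) := fun z => Iff.rfl
  obtain ⟨f, hf, hfx⟩ := ProperCone.hyperplane_separation_point _ (mt (hcl x).1 hx)
  have hrep : ∀ z : κ → ℝ, f z = ∑ k, f (Pi.single k 1) * z k := fun z => by
    conv_lhs => rw [pi_eq_sum_univ' z]
    simp [map_sum, mul_comm]
  refine ⟨fun k => f (Pi.single k 1), fun c hc => ?_, ?_⟩
  · rw [← hrep]; exact hf c ((hcl c).2 (subset_closure hc))
  · rwa [← hrep]

/-- A weight `c` on the edges of a complete digraph is dominated by a potential difference if no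
circulation has positive total weight. This is linear programming duality: the weights
`F j - F i - s i j` with `s ≥ 0` form a closed cone, and a functional separating `c` from it is the
negative of a circulation. -/
theorem exists_potential {κ : Type*} [Fintype κ] [DecidableEq κ] [Nonempty κ] (c : κ → κ → ℝ)
    (h : ∀ l : κ → κ → ℝ, (∀ i j, 0 ≤ l i j) → (∀ k, ∑ i, l i k = ∑ j, l k j) →
      ∑ i, ∑ j, l i j * c i j ≤ 0) :
    ∃ F : κ → ℝ, ∀ i j, c i j ≤ F j - F i := by
  obtain ⟨i₀⟩ := ‹Nonempty κ›
  let K : PointedCone ℝ ((κ → ℝ) × (κ × κ → ℝ)) :=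
    { carrier := {p | p.1 i₀ = 0 ∧ ∀ q, 0 ≤ p.2 q}
      zero_mem' := by simp
      add_mem' := fun {a b} ha hb => ⟨by simp [ha.1, hb.1], fun q => add_nonneg (ha.2 q) (hb.2 q)⟩
      smul_mem' := fun t a ha => ⟨by
        have := ha.1
        change t.1 * a.1 i₀ = 0
        rw [this, mul_zero], fun q => mul_nonneg t.2 (ha.2 q)⟩ }
  let T : ((κ → ℝ) × (κ × κ → ℝ)) →ₗ[ℝ] (κ × κ → ℝ) :=
    { toFun := fun p q => p.1 q.2 - p.1 q.1 - p.2 q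
      map_add' := fun a b => by ext q; simp; ring
      map_smul' := fun t a => by ext q; simp; ring }
  have hclosed : IsClosed ((K.map T : PointedCone ℝ (κ × κ → ℝ)) : Set (κ × κ → ℝ)) := by
    refine isClosed_map_of_forall_eq_zero T (K := K) ?_ (fun x hx t ht => K.smul_mem ht hx) ?_
    · have : (K : Set ((κ → ℝ) × (κ × κ → ℝ))) = {p | p.1 i₀ = 0} ∩ ⋂ q, {p | 0 ≤ p.2 q} := by
        ext p; simp [K, Set.mem_iInter]
      rw [this]
      exact (isClosed_eq (by fun_prop) continuous_const).inter
        (isClosed_iInter fun q => isClosed_le continuous_const (by fun_prop))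
    · rintro ⟨F, s⟩ ⟨hF, hs⟩ h0
      have h1 : ∀ i j, s (i, j) = F j - F i := fun i j => by
        have := congrFun h0 (i, j)
        simp only [T, LinearMap.coe_mk, AddHom.coe_mk, Pi.zero_apply] at this
        linarith
      have hF' : ∀ i, F i = 0 := fun i => by
        have a := hs (i, i₀)
        have b := hs (i₀, i)
        simp only [h1] at a b hF
        linarith
      ext q
      · exact hF' q
      · change s (q.1, q.2) = 0
        rw [h1, hF', hF', sub_zero]
  by_cases hc : (fun q : κ × κ => c q.1 q.2) ∈ (K.map T : PointedCone ℝ (κ × κ → ℝ))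
  · obtain ⟨⟨F, s⟩, hFs, he⟩ := hc
    refine ⟨F, fun i j => ?_⟩
    have h1 : F j - F i - s (i, j) = c i j := congrFun he (i, j)
    linarith [hFs.2 (i, j)]
  · exfalso
    obtain ⟨l, hl, hlc⟩ := exists_sum_mul_neg_of_notMem_closure (by rwa [hclosed.closure_eq])
    -- Testing on the slack directions gives the sign of `l`, testing on potentials
    -- gives conservation of flow.
    have hs : ∀ i j, l (i, j) ≤ 0 := fun i j => by
      have := hl (T (0, Pi.single (i, j) 1)) ⟨_, ⟨rfl,
        (Pi.single_nonneg.2 zero_le_one : (0 : κ × κ → ℝ) ≤ Pi.single (i, j) 1)⟩, rfl⟩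
      simp [T, Pi.single_apply] at this
      linarith
    have hF : ∀ F : κ → ℝ, 0 ≤ ∑ q : κ × κ, l q * (F q.2 - F q.1) := fun F => by
      have := hl (T (fun i => F i - F i₀, 0)) ⟨_, ⟨by simp, fun q => by simp⟩, rfl⟩
      simpa [T] using this
    have hflow : ∀ k, ∑ i, l (i, k) = ∑ j, l (k, j) := fun k => by
      have h1 := hF (Pi.single k 1)
      have h2 := hF (-Pi.single k 1)
      simp [Fintype.sum_prod_type, Pi.single_apply, mul_sub, Finset.sum_sub_distrib,
        mul_add, Finset.sum_add_distrib] at h1 h2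
      rw [Finset.sum_comm] at h1 h2
      simp at h1 h2
      linarith
    have := h (fun i j => -l (i, j)) (fun i j => neg_nonneg.2 (hs i j))
      (fun k => by simp [hflow k])
    simp only [Fintype.sum_prod_type] at hlc
    simp at this
    linarith

end Cones

/-! ### Doubly hyperdominant matrices and cyclic monotonicity -/

section Hyperdominant

variable {N : ℕ}

/-- A doubly hyperdominant matrix gains a first row and column that make all row and column sums
zero and keep the off-diagonal entries nonpositive. The new index stands for the minimizer. -/
theorem DoublyHyperdominant.exists_extension {H : Matrix (Fin N) (Fin N) ℝ}
    (hH : DoublyHyperdominant H) :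
    ∃ G : Matrix (Fin (N + 1)) (Fin (N + 1)) ℝ, G.submatrix Fin.succ Fin.succ = H ∧
      (∀ i j, i ≠ j → G i j ≤ 0) ∧ (∀ i, ∑ j, G i j = 0) ∧ ∀ j, ∑ i, G i j = 0 := by
  refine ⟨Matrix.of (Fin.cons (Fin.cons (∑ i, ∑ j, H i j) fun j => -∑ i, H i j)
    fun i => Fin.cons (-∑ j, H i j) fun j => H i j), ?_, ?_, ?_, ?_⟩
  · ext i j; simp
  · intro i j
    induction i using Fin.cases <;> induction j using Fin.cases
    · simp
    · simpa using fun _ => hH.colSum _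
    · simpa using hH.rowSum _
    · simpa using hH.offDiag _ _
  · intro i
    induction i using Fin.cases
    · simp only [Fin.sum_univ_succ, of_apply, Fin.cons_zero, Fin.cons_succ,
        Finset.sum_neg_distrib]
      rw [Finset.sum_comm]
      ring
    · simp [Fin.sum_univ_succ]
  · intro j
    induction j using Fin.cases <;> simp [Fin.sum_univ_succ]

theorem DoublyHyperdominant.of_circulation {G : Matrix (Fin (N + 1)) (Fin (N + 1)) ℝ}
    (h : ∀ i j, i ≠ j → G i j ≤ 0) (hrow : ∀ i, ∑ j, G i j = 0) (hcol : ∀ j, ∑ i, G i j = 0) :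
    DoublyHyperdominant (G.submatrix Fin.succ Fin.succ) := by
  refine ⟨fun i j hij => h _ _ (by simpa using hij), fun i => ?_, fun j => ?_⟩
  · have h1 := hrow i.succ
    rw [Fin.sum_univ_succ] at h1
    have h2 := h i.succ 0 (Fin.succ_ne_zero i)
    simp only [submatrix_apply]
    linarith
  · have h1 := hcol j.succ
    rw [Fin.sum_univ_succ] at h1
    have h2 := h 0 j.succ (Fin.succ_ne_zero j).symm
    simp only [submatrix_apply]
    linarith

/-- By Birkhoff's theorem, doubly hyperdominant matrices are the conic combinations of the
matrices `Qmat π`: the zero-sum extension is a multiple of `1 - D` with `D` doubly stochastic. -/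
theorem DoublyHyperdominant.exists_eq_sum_Qmat {H : Matrix (Fin N) (Fin N) ℝ}
    (hH : DoublyHyperdominant H) :
    ∃ c : Equiv.Perm (Fin (N + 1)) → ℝ, (∀ π, 0 ≤ c π) ∧ H = ∑ π, c π • Qmat π := by
  obtain ⟨G, rfl, hoff, hrow, hcol⟩ := hH.exists_extension
  set s : ℝ := 1 + ∑ i, |G i i| with hs
  have hs0 : 0 < s := by positivity
  have hdiag : ∀ i, G i i ≤ s := fun i => by
    have := Finset.single_le_sum (f := fun i => |G i i|) (fun i _ => abs_nonneg _)
      (Finset.mem_univ i)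
    linarith [le_abs_self (G i i)]
  have hD : (1 - s⁻¹ • G) ∈ doublyStochastic ℝ (Fin (N + 1)) := by
    rw [mem_doublyStochastic_iff_sum]
    refine ⟨fun i j => ?_, fun i => ?_, fun j => ?_⟩
    · rcases eq_or_ne i j with rfl | hij
      · simp only [Matrix.sub_apply, one_apply_eq, Matrix.smul_apply, smul_eq_mul, sub_nonneg]
        rw [← div_eq_inv_mul, div_le_one hs0]
        exact hdiag i
      · simp only [Matrix.sub_apply, one_apply_ne hij, Matrix.smul_apply, smul_eq_mul, zero_sub,
          Left.nonneg_neg_iff]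
        exact mul_nonpos_of_nonneg_of_nonpos (inv_pos.2 hs0).le (hoff i j hij)
    · simp [Finset.sum_sub_distrib, ← Finset.mul_sum, hrow, one_apply]
    · simp [Finset.sum_sub_distrib, ← Finset.mul_sum, hcol, one_apply]
  obtain ⟨w, hw0, hw1, hw⟩ := exists_eq_sum_perm_of_mem_doublyStochastic hD
  refine ⟨fun π => s * w π, fun π => mul_nonneg hs0.le (hw0 π), ?_⟩
  have hG : G = ∑ π, (s * w π) • (1 - Equiv.Perm.permMatrix ℝ π) := by
    simp only [mul_smul, ← Finset.smul_sum, smul_sub, Finset.sum_sub_distrib, hw,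
      ← Finset.sum_smul, hw1]
    simp [smul_smul, hs0.ne']
  ext i j
  conv_lhs => rw [hG]
  simp [Matrix.sum_apply, Qmat]

variable {E : Type*} [NormedAddCommGroup E] [InnerProductSpace ℝ E]

theorem sum_inner_sub_eq {κ : Type*} [Fintype κ] (G : Matrix κ κ ℝ) (hrow : ∀ i, ∑ j, G i j = 0)
    (w h : κ → E) :
    ∑ i, ∑ j, G i j * inner ℝ (w i) (h j - h i) = ∑ i, ∑ j, G i j * inner ℝ (w i) (h j) := by
  simp [inner_sub_right, mul_sub, Finset.sum_sub_distrib, ← Finset.sum_mul, hrow]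

theorem sum_inner_cons_eq (G : Matrix (Fin (N + 1)) (Fin (N + 1)) ℝ) (w h : Fin N → E) :
    ∑ i, ∑ j, G i j * inner ℝ ((Fin.cons 0 w : Fin (N + 1) → E) i)
        ((Fin.cons 0 h : Fin (N + 1) → E) j)
      = ∑ i, ∑ j, G.submatrix Fin.succ Fin.succ i j * inner ℝ (w i) (h j) := by
  simp [Fin.sum_univ_succ]

/-- A potential for the data together with the point `(0, 0)` gives nonnegativity of all doubly
hyperdominant multipliers. -/
theorem DoublyHyperdominant.sum_inner_nonneg {H : Matrix (Fin N) (Fin N) ℝ}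
    (hH : DoublyHyperdominant H) {w h : Fin N → E} {F : Fin (N + 1) → ℝ}
    (hF : ∀ i j, inner ℝ ((Fin.cons 0 w : Fin (N + 1) → E) i)
      ((Fin.cons 0 h : Fin (N + 1) → E) j - (Fin.cons 0 h : Fin (N + 1) → E) i) ≤ F j - F i) :
    0 ≤ ∑ i, ∑ j, H i j * inner ℝ (w i) (h j) := by
  obtain ⟨G, rfl, hoff, hrow, hcol⟩ := hH.exists_extension
  rw [← sum_inner_cons_eq, ← sum_inner_sub_eq G hrow]
  have h0 : ∑ i, ∑ j, G i j * (F j - F i) = 0 := by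
    have : ∑ i, ∑ j, G i j * F j = 0 := by
      rw [Finset.sum_comm]
      simp [← Finset.sum_mul, hcol]
    simp [mul_sub, Finset.sum_sub_distrib, ← Finset.sum_mul, hrow, this]
  rw [← h0]
  refine Finset.sum_le_sum fun i _ => Finset.sum_le_sum fun j _ => ?_
  rcases eq_or_ne i j with rfl | hij
  · simp
  · exact mul_le_mul_of_nonpos_left (hF i j) (hoff i j hij)

/-- Converse of `DoublyHyperdominant.sum_inner_nonneg`: the circulations of `exists_potential` are,
up to sign and diagonal, the zero-sum extensions of doubly hyperdominant matrices. -/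
theorem exists_potential_of_forall_doublyHyperdominant (w h : Fin N → E)
    (hyp : ∀ H : Matrix (Fin N) (Fin N) ℝ, DoublyHyperdominant H →
      0 ≤ ∑ i, ∑ j, H i j * inner ℝ (w i) (h j)) :
    ∃ F : Fin (N + 1) → ℝ, ∀ i j, inner ℝ ((Fin.cons 0 w : Fin (N + 1) → E) i)
      ((Fin.cons 0 h : Fin (N + 1) → E) j - (Fin.cons 0 h : Fin (N + 1) → E) i) ≤ F j - F i := by
  refine exists_potential _ fun l hl hflow => ?_
  let G : Matrix (Fin (N + 1)) (Fin (N + 1)) ℝ :=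
    Matrix.diagonal (fun i => ∑ k, l i k) - Matrix.of l
  have hrow : ∀ i, ∑ j, G i j = 0 := fun i => by
    simp [G, Finset.sum_sub_distrib, Matrix.diagonal_apply]
  have hcol : ∀ j, ∑ i, G i j = 0 := fun j => by
    simp [G, Finset.sum_sub_distrib, Matrix.diagonal_apply, hflow]
  have := hyp _ (DoublyHyperdominant.of_circulation (G := G) (fun i j hij => by
    simp [G, Matrix.diagonal_apply_ne _ hij, hl]) hrow hcol)
  rw [← sum_inner_cons_eq, ← sum_inner_sub_eq G hrow] at this
  have e : ∀ i j, G i j * inner ℝ ((Fin.cons 0 w : Fin (N + 1) → E) i)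
      ((Fin.cons 0 h : Fin (N + 1) → E) j - (Fin.cons 0 h : Fin (N + 1) → E) i)
      = -(l i j * inner ℝ ((Fin.cons 0 w : Fin (N + 1) → E) i)
      ((Fin.cons 0 h : Fin (N + 1) → E) j - (Fin.cons 0 h : Fin (N + 1) → E) i)) := fun i j => by
    rcases eq_or_ne i j with rfl | hij
    · simp
    · simp [G, Matrix.diagonal_apply_ne _ hij]
  simp only [e, Finset.sum_neg_distrib] at this
  linarith

end Hyperdominant

/-! ### Block vectors and quadratic forms -/

section BlockMul

variable {ι κ ν : Type*} [Fintype ι] [Fintype κ] {E : Type*} [NormedAddCommGroup E]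
  [InnerProductSpace ℝ E]

/-- The product `(M ⊗ I) η` of a matrix with a block vector. -/
def blockMul (M : Matrix κ ι ℝ) (η : ι → E) (k : κ) : E := ∑ i, M k i • η i

theorem blockMul_mul (A : Matrix ν κ ℝ) (B : Matrix κ ι ℝ) (η : ι → E) :
    blockMul (A * B) η = blockMul A (blockMul B η) := by
  ext k
  simp only [blockMul, Matrix.mul_apply, Finset.sum_smul, Finset.smul_sum, mul_smul]
  exact Finset.sum_comm

theorem norm_sq_sum_smul_le (a : ι → ℝ) (η : ι → E) :
    ‖∑ i, a i • η i‖ ^ 2 ≤ (∑ i, a i ^ 2) * ∑ i, ‖η i‖ ^ 2 := by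
  have h1 : ‖∑ i, a i • η i‖ ≤ ∑ i, |a i| * ‖η i‖ :=
    (norm_sum_le _ _).trans_eq (by simp [norm_smul])
  have h2 := Finset.sum_mul_sq_le_sq_mul_sq Finset.univ (fun i => |a i|) (fun i => ‖η i‖)
  simp only [sq_abs] at h2
  exact (pow_le_pow_left₀ (norm_nonneg _) h1 2).trans h2

end BlockMul

section QuadForm

variable {ι κ : Type*} [Fintype ι] [Fintype κ] {d : ℕ}

theorem quadForm_add (A B : Matrix ι ι ℝ) (η : ι → Vec d) :
    quadForm (A + B) η = quadForm A η + quadForm B η := by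
  simp [quadForm, add_mul, Finset.sum_add_distrib]

theorem quadForm_sub (A B : Matrix ι ι ℝ) (η : ι → Vec d) :
    quadForm (A - B) η = quadForm A η - quadForm B η := by
  simp [quadForm, sub_mul, Finset.sum_sub_distrib]

theorem quadForm_smul (c : ℝ) (A : Matrix ι ι ℝ) (η : ι → Vec d) :
    quadForm (c • A) η = c * quadForm A η := by
  simp [quadForm, Finset.mul_sum, mul_assoc]

theorem quadForm_sum {α : Type*} (s : Finset α) (A : α → Matrix ι ι ℝ) (η : ι → Vec d) :
    quadForm (∑ a ∈ s, A a) η = ∑ a ∈ s, quadForm (A a) η := by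
  classical
  induction s using Finset.induction_on with
  | empty => simp [quadForm]
  | insert a s ha ih => rw [Finset.sum_insert ha, Finset.sum_insert ha, quadForm_add, ih]

theorem quadForm_one [DecidableEq ι] (η : ι → Vec d) :
    quadForm (1 : Matrix ι ι ℝ) η = ∑ i, ‖η i‖ ^ 2 := by
  simp [quadForm, one_apply]

theorem quadForm_transpose_mul (A B : Matrix κ ι ℝ) (η : ι → Vec d) :
    quadForm (Aᵀ * B) η = ∑ k, inner ℝ (blockMul A η k) (blockMul B η k) := by
  have h : ∀ k, inner ℝ (blockMul A η k) (blockMul B η k)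
      = ∑ i, ∑ j, A k i * B k j * inner ℝ (η i) (η j) := fun k => by
    simp only [blockMul, sum_inner, inner_sum, inner_smul_left, inner_smul_right, conj_trivial,
      mul_assoc, Finset.mul_sum]
    rw [Finset.sum_comm]
    exact Finset.sum_congr rfl fun i _ => Finset.sum_congr rfl fun j _ => mul_left_comm _ _ _
  simp only [quadForm, h, Matrix.mul_apply, transpose_apply, Finset.sum_mul]
  conv_rhs => rw [Finset.sum_comm]
  exact Finset.sum_congr rfl fun i _ => Finset.sum_comm

open scoped MatrixOrder Matrix.Norms.L2Operator in
theorem exists_eq_transpose_mul_self {S : Matrix ι ι ℝ} (hS : S.PosSemidef) :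
    ∃ B : Matrix ι ι ℝ, S = Bᵀ * B := by
  classical
  obtain ⟨B, hB⟩ := CStarAlgebra.nonneg_iff_eq_star_mul_self.mp hS.nonneg
  exact ⟨B, by rw [hB, star_eq_conjTranspose, conjTranspose_eq_transpose_of_trivial]⟩

theorem quadForm_nonneg {S : Matrix ι ι ℝ} (hS : S.PosSemidef) (η : ι → Vec d) :
    0 ≤ quadForm S η := by
  obtain ⟨B, rfl⟩ := exists_eq_transpose_mul_self hS
  rw [quadForm_transpose_mul]
  exact Finset.sum_nonneg fun k _ => real_inner_self_nonneg

theorem posSemidef_of_quadForm_nonneg {S : Matrix ι ι ℝ} (hS : Sᵀ = S)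
    (h : ∀ η : ι → Vec 1, 0 ≤ quadForm S η) : S.PosSemidef := by
  refine PosSemidef.of_dotProduct_mulVec_nonneg
    (by rwa [IsHermitian, conjTranspose_eq_transpose_of_trivial]) fun v => ?_
  have := h fun i => EuclideanSpace.single 0 (v i)
  simp only [quadForm, EuclideanSpace.inner_single_left, PiLp.single_apply, if_true,
    conj_trivial] at this
  simp only [dotProduct, mulVec, Finset.mul_sum, star_trivial]
  refine this.trans_eq (Finset.sum_congr rfl fun i _ => Finset.sum_congr rfl fun j _ => ?_)
  ring

theorem eq_zero_of_quadForm_eq_zero {S : Matrix ι ι ℝ} (hS : S.PosSemidef) {η : ι → Vec d}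
    (hη : LinearIndependent ℝ η) (h : quadForm S η = 0) : S = 0 := by
  obtain ⟨B, rfl⟩ := exists_eq_transpose_mul_self hS
  rw [quadForm_transpose_mul, Finset.sum_eq_zero_iff_of_nonneg
    fun k _ => real_inner_self_nonneg] at h
  have hB : B = 0 := by
    ext k i
    exact Fintype.linearIndependent_iff.1 hη (B k)
      (inner_self_eq_zero.1 (h k (Finset.mem_univ k))) i
  simp [hB]

theorem linearIndependent_of_card_le_rank {η : ι → Vec d}
    (h : Fintype.card ι ≤ (Matrix.of fun (a : Fin d) (i : ι) => η i a).rank) :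
    LinearIndependent ℝ η := by
  have h1 : LinearIndependent ℝ (Matrix.of fun (a : Fin d) (i : ι) => η i a).col := by
    rw [linearIndependent_iff_card_le_finrank_span]
    rwa [rank_eq_finrank_span_cols] at h
  exact LinearIndependent.of_comp (WithLp.linearEquiv 2 ℝ (Fin d → ℝ)).toLinearMap h1

/-- A positive semidefinite matrix is a Gram matrix of vectors in `ℝ^d` when `d` is at least its
size. -/
theorem exists_inner_eq_of_posSemidef {G : Matrix ι ι ℝ} (hG : G.PosSemidef)
    (hd : Fintype.card ι ≤ d) : ∃ η : ι → Vec d, ∀ i j, inner ℝ (η i) (η j) = G i j := by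
  obtain ⟨B, rfl⟩ := exists_eq_transpose_mul_self hG
  let e : ι → Fin d := fun i => Fin.castLE hd (Fintype.equivFin ι i)
  have he : Function.Injective e :=
    (Fin.castLE_injective hd).comp (Fintype.equivFin ι).injective
  refine ⟨fun i => ∑ k, B k i • EuclideanSpace.basisFun (Fin d) ℝ (e k), fun i j => ?_⟩
  have hon := (EuclideanSpace.basisFun (Fin d) ℝ).orthonormal.comp e he
  have := hon.inner_sum (fun k => B k i) (fun k => B k j) Finset.univ
  simpa [Matrix.mul_apply] using this

/-- The pairing of a symmetric matrix `X` with `l` only sees the symmetric part of `l`. -/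
theorem quadForm_eq_sum_mul {X : Matrix ι ι ℝ} (hX : Xᵀ = X) (l : ι × ι → ℝ) {η : ι → Vec d}
    (hη : ∀ i j, inner ℝ (η i) (η j) = (l (i, j) + l (j, i)) / 2) :
    quadForm X η = ∑ q : ι × ι, l q * X q.1 q.2 := by
  have hX' : ∀ i j, X j i = X i j := fun i j => congrFun (congrFun hX i) j
  have h1 : ∑ i, ∑ j, l (j, i) * X i j = ∑ i, ∑ j, l (i, j) * X i j := by
    rw [Finset.sum_comm]
    simp only [hX']
  simp only [Fintype.sum_prod_type, quadForm, hη]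
  have : ∀ i j, X i j * ((l (i, j) + l (j, i)) / 2)
      = (l (i, j) * X i j) / 2 + (l (j, i) * X i j) / 2 := fun i j => by ring
  simp only [this, Finset.sum_add_distrib, ← Finset.sum_div, h1]
  ring

theorem neg_mul_le_quadForm {X : Matrix ι ι ℝ} {δ : ℝ} (hX : ∀ i j, |X i j| ≤ δ)
    (η : ι → Vec d) : -(δ * Fintype.card ι * ∑ i, ‖η i‖ ^ 2) ≤ quadForm X η := by
  have h1 : ∀ i j, -(δ * ((‖η i‖ ^ 2 + ‖η j‖ ^ 2) / 2)) ≤ X i j * inner ℝ (η i) (η j) :=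
    fun i j => by
      have h2 := abs_real_inner_le_norm (η i) (η j)
      have h3 : ‖η i‖ * ‖η j‖ ≤ (‖η i‖ ^ 2 + ‖η j‖ ^ 2) / 2 := by
        nlinarith [sq_nonneg (‖η i‖ - ‖η j‖)]
      refine neg_le_of_abs_le ?_
      rw [abs_mul]
      exact mul_le_mul (hX i j) (h2.trans h3) (abs_nonneg _) ((abs_nonneg _).trans (hX i j))
  refine le_trans (le_of_eq ?_)
    (Finset.sum_le_sum fun i _ => Finset.sum_le_sum fun j _ => h1 i j)
  simp only [Finset.sum_neg_distrib, ← Finset.mul_sum, ← Finset.sum_div, Finset.sum_add_distrib,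
    Finset.sum_const, Finset.card_univ, nsmul_eq_mul]
  ring

end QuadForm

/-! ### The algorithm as a linear recursion -/

namespace Algorithm

variable {n : ℕ} (alg : Algorithm n) (N : ℕ) {d : ℕ}

theorem multiplier_eq (m L : ℝ) (H : Matrix (Fin N) (Fin N) ℝ) :
    alg.multiplier N m L H
      = (alg.R2L N L)ᵀ * (H * alg.R2m N m) + (H * alg.R2m N m)ᵀ * alg.R2L N L := by
  rw [multiplier, Matrix.mul_assoc, fromBlocks_mul_fromRows, transpose_fromRows,
    fromCols_mul_fromRows, transpose_mul, Matrix.mul_assoc]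
  simp

theorem multiplier_add (m L : ℝ) (H K : Matrix (Fin N) (Fin N) ℝ) :
    alg.multiplier N m L (H + K) = alg.multiplier N m L H + alg.multiplier N m L K := by
  simp only [multiplier_eq, Matrix.add_mul, Matrix.mul_add, transpose_add]
  abel

theorem multiplier_smul (m L c : ℝ) (H : Matrix (Fin N) (Fin N) ℝ) :
    alg.multiplier N m L (c • H) = c • alg.multiplier N m L H := by
  simp only [multiplier_eq, Matrix.smul_mul, Matrix.mul_smul, transpose_smul, smul_add]

theorem multiplier_transpose (m L : ℝ) (H : Matrix (Fin N) (Fin N) ℝ) :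
    (alg.multiplier N m L H)ᵀ = alg.multiplier N m L H := by
  simp only [multiplier_eq, transpose_add, transpose_mul, transpose_transpose]
  rw [add_comm]

theorem M₀_transpose (b : ℝ) : (alg.M₀ N b)ᵀ = alg.M₀ N b := by
  simp [M₀, transpose_sub, transpose_smul, transpose_mul]

/-- `w_k = L y_k - u_k` as a function of `η`. -/
theorem blockMul_R2L (L : ℝ) (η : Fin n ⊕ Fin N → Vec d) (k : Fin N) :
    blockMul (alg.R2L N L) η k = L • blockMul (alg.outputMat N k) η 0 - η (Sum.inr k) := by
  simp [blockMul, R2L, Ymat, Umat, sub_smul, Finset.sum_sub_distrib, mul_smul,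
    Finset.smul_sum, one_apply]

/-- `h_k = u_k - m y_k` as a function of `η`. -/
theorem blockMul_R2m (m : ℝ) (η : Fin n ⊕ Fin N → Vec d) (k : Fin N) :
    blockMul (alg.R2m N m) η k = η (Sum.inr k) - m • blockMul (alg.outputMat N k) η 0 := by
  simp [blockMul, R2m, Ymat, Umat, sub_smul, Finset.sum_sub_distrib, mul_smul,
    Finset.smul_sum, one_apply]

theorem quadForm_multiplier (m L : ℝ) (H : Matrix (Fin N) (Fin N) ℝ)
    (η : Fin n ⊕ Fin N → Vec d) :
    quadForm (alg.multiplier N m L H) η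
      = 2 * ∑ i, ∑ j, H i j *
          inner ℝ (L • blockMul (alg.outputMat N i) η 0 - η (Sum.inr i))
            (η (Sum.inr j) - m • blockMul (alg.outputMat N j) η 0) := by
  rw [multiplier_eq, quadForm_add, quadForm_transpose_mul, quadForm_transpose_mul]
  rw [Finset.sum_congr rfl fun k _ => real_inner_comm (blockMul (alg.R2L N L) η k)
    (blockMul (H * alg.R2m N m) η k), ← two_mul, blockMul_mul]
  congr 1
  refine Finset.sum_congr rfl fun i _ => ?_
  rw [show blockMul H (blockMul (alg.R2m N m) η) i = ∑ j, H i j • blockMul (alg.R2m N m) η j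
    from rfl, inner_sum]
  simp only [inner_smul_right, blockMul_R2L, blockMul_R2m]

theorem quadForm_R₀ (η : Fin n ⊕ Fin N → Vec d) :
    quadForm ((alg.R₀ N)ᵀ * alg.R₀ N) η = ∑ i, ‖η (Sum.inl i)‖ ^ 2 := by
  rw [quadForm_transpose_mul]
  simp [blockMul, R₀, one_apply]

theorem quadForm_M₀ (b : ℝ) (η : Fin n ⊕ Fin N → Vec d) :
    quadForm (alg.M₀ N b) η
      = b ^ 2 * ∑ i, ‖η (Sum.inl i)‖ ^ 2 - ‖blockMul (alg.outputMat N N) η 0‖ ^ 2 := by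
  rw [M₀, quadForm_sub, quadForm_smul, quadForm_R₀, quadForm_transpose_mul]
  simp [R₁]

/-- Causality: `x_k` does not depend on `u_j` for `j ≥ k`. -/
theorem stateMat_apply_inr_eq_zero (k : ℕ) (i : Fin n) (j : Fin N) (hj : k ≤ j) :
    alg.stateMat N k i (Sum.inr j) = 0 := by
  induction k generalizing i with
  | zero => simp [stateMat]
  | succ k ih =>
    have hne : (j : ℕ) ≠ k := by omega
    simp [stateMat, Matrix.mul_apply, inputMat, hne, fun l => ih l (by omega)]

theorem outputMat_apply_inr_eq_zero (k : ℕ) (j : Fin N) (hj : k ≤ j) :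
    alg.outputMat N k 0 (Sum.inr j) = 0 := by
  simp [outputMat, Matrix.mul_apply, fun i => alg.stateMat_apply_inr_eq_zero N k i j hj]

variable {N}

/-- A run of the algorithm, relative to an optimal state, is the linear recursion driven by the
gradients. -/
theorem state_sub_eq {f : Vec d → ℝ} {x₀ xs : State n d} (hxs : ∀ k < N, xs = alg.applyA k xs)
    {η : Fin n ⊕ Fin N → Vec d} (h0 : ∀ i, η (Sum.inl i) = x₀ i - xs i) {k : ℕ} (hk : k ≤ N)
    (hu : ∀ j : Fin N, (j : ℕ) < k → η (Sum.inr j) = gradient f (alg.output f x₀ j)) (i : Fin n) :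
    alg.state f x₀ k i - xs i = blockMul (alg.stateMat N k) η i := by
  induction k generalizing i with
  | zero => simp [state, stateMat, blockMul, one_apply, h0]
  | succ k ih =>
    have ih' := ih (by omega) fun j hj => hu j (by omega)
    have h1 : blockMul (alg.inputMat N k) η = fun _ => gradient f (alg.output f x₀ k) := by
      ext1 a
      rw [← hu ⟨k, by omega⟩ (by simp)]
      simp only [blockMul, inputMat, Fintype.sum_sum_type, fromCols_apply_inl,
        fromCols_apply_inr, Matrix.zero_apply, zero_smul, Finset.sum_const_zero, zero_add, of_apply,
        ite_smul, one_smul]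
      rw [Finset.sum_eq_single ⟨k, by omega⟩ (fun b _ hb => if_neg fun h => hb (Fin.ext h))
        (by simp), if_pos rfl]
    have h2 : blockMul (alg.stateMat N (k + 1)) η i
        = blockMul (alg.A k) (blockMul (alg.stateMat N k) η) i
          + blockMul (alg.B k) (blockMul (alg.inputMat N k) η) i := by
      rw [← blockMul_mul, ← blockMul_mul]
      simp [blockMul, stateMat, add_smul, Finset.sum_add_distrib]
    rw [h2, h1, ← funext ih']
    have h3 : xs i = ∑ j, alg.A k i j • xs j := by
      conv_lhs => rw [hxs k (by omega)]
      rfl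
    rw [h3]
    simp only [state, applyA, applyB, PiLp.add_apply, blockMul, smul_sub, Finset.sum_sub_distrib,
      Finset.univ_unique, Finset.sum_singleton, Fin.default_eq_zero]
    rw [output]
    abel

theorem output_sub_eq {f : Vec d → ℝ} {x₀ xs : State n d} {ys : Vec d}
    (hopt : alg.IsOptimalState N ys xs)
    {η : Fin n ⊕ Fin N → Vec d} (h0 : ∀ i, η (Sum.inl i) = x₀ i - xs i) {k : ℕ} (hk : k ≤ N)
    (hu : ∀ j : Fin N, (j : ℕ) < k → η (Sum.inr j) = gradient f (alg.output f x₀ j)) :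
    alg.output f x₀ k - ys = blockMul (alg.outputMat N k) η 0 := by
  rw [outputMat, blockMul_mul, ← funext (alg.state_sub_eq hopt.1 h0 hk hu), hopt.2 k hk]
  simp [output, applyC, blockMul, smul_sub, Finset.sum_sub_distrib]

end Algorithm

/-! ### Performance bounds and certificates -/

theorem SmL.isMinOn_of_gradient_eq_zero {d : ℕ} {m L : ℝ} (hm : 0 ≤ m) {f : Vec d → ℝ}
    (hf : SmL m L f) {ys : Vec d} (h : gradient f ys = 0) : IsMinOn f Set.univ ys := fun z _ => by
  have := (hf.smoothStrong ys z).1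
  rw [h, inner_zero_left] at this
  have h2 : 0 ≤ m / 2 * ‖z - ys‖ ^ 2 := by positivity
  change f ys ≤ f z
  linarith

theorem gradient_eq_zero_of_isMinOn {d : ℕ} {f : Vec d → ℝ} {ys : Vec d}
    (h : IsMinOn f Set.univ ys) : gradient f ys = 0 := by
  rw [gradient, (h.isLocalMin Filter.univ_mem).fderiv_eq_zero, map_zero]

namespace Algorithm

variable {n : ℕ} (alg : Algorithm n) {N d : ℕ} {m L : ℝ}

/-- Weak duality: a feasible `b` is a performance bound. -/
theorem isBound_of_mem_sdpFeasible (hmL : m < L) {b : ℝ} (hb : b ∈ alg.sdpFeasible N m L) :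
    alg.IsBound d N m L b := by
  obtain ⟨hb0, H, hH, hpsd⟩ := hb
  intro f hf ys hys xs hopt x₀
  have hgrad := gradient_eq_zero_of_isMinOn hys
  let η : Fin n ⊕ Fin N → Vec d := Sum.elim (fun i => x₀ i - xs i)
    fun j => gradient f (alg.output f x₀ j)
  have hout : ∀ k ≤ N, alg.output f x₀ k - ys = blockMul (alg.outputMat N k) η 0 := fun k hk =>
    alg.output_sub_eq hopt (fun _ => rfl) hk fun _ _ => rfl
  have hmul : 0 ≤ quadForm (alg.multiplier N m L H) η := by
    rw [quadForm_multiplier]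
    refine mul_nonneg zero_le_two ?_
    -- Index `0` is the minimizer, where both transformed vectors vanish.
    let a : Fin (N + 1) → Vec d := Fin.cons ys fun k : Fin N => alg.output f x₀ k
    have hw : ∀ i, (Fin.cons 0 (fun k : Fin N =>
        L • blockMul (alg.outputMat N k) η 0 - η (Sum.inr k)) : Fin (N + 1) → Vec d) i
        = L • (a i - ys) - gradient f (a i) := fun i => by
      induction i using Fin.cases with
      | zero => simp [a, hgrad]
      | succ i => simp [a, ← hout i i.2.le, η]
    have hh : ∀ i, (Fin.cons 0 (fun k : Fin N =>
        η (Sum.inr k) - m • blockMul (alg.outputMat N k) η 0) : Fin (N + 1) → Vec d) i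
        = gradient f (a i) - m • (a i - ys) := fun i => by
      induction i using Fin.cases with
      | zero => simp [a, hgrad]
      | succ i => simp [a, ← hout i i.2.le, η]
    refine hH.sum_inner_nonneg (F := fun i => (L - m) * (inner ℝ (gradient f (a i)
      - m • (a i - ys)) (a i - ys) - (f (a i) - m / 2 * ‖a i - ys‖ ^ 2))
        - ‖gradient f (a i) - m • (a i - ys)‖ ^ 2 / 2) fun i j => ?_
    rw [hw, hh, hh]
    exact hf.smoothStrong.interpolation hmL ys (a i) (a j)
  have h1 := quadForm_nonneg hpsd η
  rw [quadForm_sub, quadForm_M₀, ← hout N le_rfl] at h1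
  have h2 : ∑ i, ‖η (Sum.inl i)‖ ^ 2 = ‖x₀ - xs‖ ^ 2 := by
    rw [PiLp.norm_sq_eq_of_L2]
    rfl
  rw [h2, ← mul_pow] at h1
  exact abs_le_of_sq_le_sq' (by linarith) (by positivity) |>.2

/-- If `η` satisfies all multiplier constraints, then it comes from a run of the algorithm on some
`f ∈ S_{m,L}`, so every bound `b` gives `b² ‖x_0‖² ≥ ‖y_N‖²`. -/
theorem quadForm_M₀_nonneg_of_isBound (hm : 0 ≤ m) (hmL : m < L) {b : ℝ}
    (hb : alg.IsBound d N m L b) (η : Fin n ⊕ Fin N → Vec d)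
    (hη : ∀ H, DoublyHyperdominant H → 0 ≤ quadForm (alg.multiplier N m L H) η) :
    0 ≤ quadForm (alg.M₀ N b) η := by
  obtain ⟨F, hF⟩ := exists_potential_of_forall_doublyHyperdominant
    (fun k : Fin N => L • blockMul (alg.outputMat N k) η 0 - η (Sum.inr k))
    (fun k : Fin N => η (Sum.inr k) - m • blockMul (alg.outputMat N k) η 0) fun H hH => by
      have := hη H hH
      rw [quadForm_multiplier] at this
      linarith
  let y : Fin (N + 1) → Vec d := Fin.cons 0 fun k : Fin N => blockMul (alg.outputMat N k) η 0
  let u : Fin (N + 1) → Vec d := Fin.cons 0 fun k : Fin N => η (Sum.inr k)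
  have hw : (Fin.cons 0 (fun k : Fin N =>
      L • blockMul (alg.outputMat N k) η 0 - η (Sum.inr k)) : Fin (N + 1) → Vec d)
      = fun i => L • y i - u i := funext fun i => by
    induction i using Fin.cases <;> simp [y, u]
  have hh : (Fin.cons 0 (fun k : Fin N =>
      η (Sum.inr k) - m • blockMul (alg.outputMat N k) η 0) : Fin (N + 1) → Vec d)
      = fun i => u i - m • y i := funext fun i => by
    induction i using Fin.cases <;> simp [y, u]
  rw [hw, hh] at hF
  obtain ⟨f, hf, hfu⟩ := exists_smL_interpolant hm hmL y u F hF
  have hmin := hf.isMinOn_of_gradient_eq_zero hm (hfu 0)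
  have hopt : alg.IsOptimalState N (0 : Vec d) (0 : State n d) :=
    ⟨fun k _ => by ext1 i; simp [applyA], fun k _ => by simp [applyC]⟩
  let x₀ : State n d := WithLp.toLp 2 fun i => η (Sum.inl i)
  have hout : ∀ k ≤ N, alg.output f x₀ k = blockMul (alg.outputMat N k) η 0 := by
    intro k
    induction k using Nat.strong_induction_on with
    | _ k ih =>
      intro hk
      have := alg.output_sub_eq hopt (η := η) (x₀ := x₀) (f := f) (fun i => by simp [x₀]) hk
        fun j hj => by
          rw [ih j hj j.2.le]
          exact (hfu j.succ).symm
      rwa [sub_zero] at this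
  have h1 := hb f hf 0 hmin 0 hopt x₀
  rw [hout N le_rfl, sub_zero, sub_zero] at h1
  have h2 : ∑ i, ‖η (Sum.inl i)‖ ^ 2 = ‖x₀‖ ^ 2 := by
    rw [PiLp.norm_sq_eq_of_L2]
  rw [quadForm_M₀, h2, ← mul_pow]
  exact sub_nonneg.2 (pow_le_pow_left₀ (norm_nonneg _) h1 2)

theorem nonneg_of_isBound (hn : 0 < n) (hd : 0 < d) (hm : 0 ≤ m) (hmL : m < L) {b : ℝ}
    (hb : alg.IsBound d N m L b) : 0 ≤ b := by
  obtain ⟨f, hf, hfu⟩ := exists_smL_interpolant (d := d) hm hmL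
    (fun _ : Unit => 0) (fun _ => 0) (fun _ => 0) (by simp)
  have hopt : alg.IsOptimalState N (0 : Vec d) (0 : State n d) :=
    ⟨fun k _ => by ext1 i; simp [applyA], fun k _ => by simp [applyC]⟩
  let x₀ : State n d := WithLp.toLp 2 fun _ => EuclideanSpace.single ⟨0, hd⟩ 1
  have hx : x₀ ≠ 0 := fun h => by
    have := congrArg (fun x : State n d => x ⟨0, hn⟩ ⟨0, hd⟩) h
    simp [x₀] at this
  have := (norm_nonneg _).trans
    (hb f hf 0 (hf.isMinOn_of_gradient_eq_zero hm (hfu ())) 0 hopt x₀)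
  rw [sub_zero] at this
  exact nonneg_of_mul_nonneg_left this (norm_pos_iff.2 hx)

theorem isClosed_setOf_isBound : IsClosed {b : ℝ | alg.IsBound d N m L b} := by
  simp only [IsBound, Set.ofPred_forall]
  exact isClosed_iInter fun f => isClosed_iInter fun _ => isClosed_iInter fun _ =>
    isClosed_iInter fun _ => isClosed_iInter fun _ => isClosed_iInter fun _ =>
    isClosed_iInter fun _ => isClosed_le continuous_const (by fun_prop)

/-! ### A coercive multiplier -/

theorem norm_sq_outputMat_le (k : ℕ) :
    ∃ K : ℝ, 0 ≤ K ∧ ∀ η : Fin n ⊕ Fin N → Vec d, ‖blockMul (alg.outputMat N k) η 0‖ ^ 2 ≤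
      K * (∑ i, ‖η (Sum.inl i)‖ ^ 2
        + ∑ j ∈ Finset.univ.filter (fun j : Fin N => (j : ℕ) < k), ‖η (Sum.inr j)‖ ^ 2) := by
  refine ⟨∑ i, alg.outputMat N k 0 i ^ 2, Finset.sum_nonneg fun i _ => sq_nonneg _, fun η => ?_⟩
  -- By causality `η` may be replaced by its truncation `ζ` to the inputs before time `k`.
  let ζ : Fin n ⊕ Fin N → Vec d := Sum.elim (fun i => η (Sum.inl i))
    fun j => if (j : ℕ) < k then η (Sum.inr j) else 0
  have h1 : blockMul (alg.outputMat N k) η 0 = ∑ i, alg.outputMat N k 0 i • ζ i := by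
    refine Finset.sum_congr rfl fun i _ => ?_
    rcases i with i | j
    · rfl
    · by_cases hj : (j : ℕ) < k
      · simp [ζ, hj]
      · simp [alg.outputMat_apply_inr_eq_zero N k j (not_lt.1 hj)]
  rw [h1]
  refine (norm_sq_sum_smul_le _ _).trans_eq ?_
  congr 1
  rw [Fintype.sum_sum_type, Finset.sum_filter]
  congr 1
  refine Finset.sum_congr rfl fun j _ => ?_
  by_cases hj : (j : ℕ) < k <;> simp [ζ, hj]

theorem norm_sq_sub_le_neg_inner {E : Type*} [NormedAddCommGroup E] [InnerProductSpace ℝ E]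
    (hm : 0 ≤ m) (hL : 0 ≤ L) (y u : E) :
    ‖u‖ ^ 2 - (L + m) ^ 2 * ‖y‖ ^ 2 ≤ -(2 * inner ℝ (L • y - u) (u - m • y)) := by
  have h1 := sq_nonneg ‖u - (L + m) • y‖
  rw [norm_sub_sq_real, inner_smul_right, norm_smul, mul_pow, Real.norm_eq_abs, sq_abs] at h1
  simp only [inner_sub_left, inner_sub_right, inner_smul_left, inner_smul_right, conj_trivial,
    real_inner_self_eq_norm_sq]
  rw [real_inner_comm u y]
  nlinarith [mul_nonneg (mul_nonneg hm hL) (sq_nonneg ‖y‖)]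

/-- A diagonal multiplier with fast decaying weights controls `u_0, …, u_{k-1}` by `x_0`. By
induction: the new constraint contributes `‖u_k‖² - (L + m)² ‖y_k‖²`, and by causality `y_k` is
controlled by the left-hand side for `k`. -/
theorem exists_coercive_diagonal (hm : 0 ≤ m) (hL : 0 ≤ L) {k : ℕ} (hk : k ≤ N) :
    ∃ c : ℝ, 0 ≤ c ∧ ∃ a : Fin N → ℝ, (∀ j, 0 ≤ a j) ∧ (∀ j : Fin N, k ≤ j → a j = 0) ∧
      ∀ η : Fin n ⊕ Fin N → Vec d,
        ∑ i, ‖η (Sum.inl i)‖ ^ 2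
            + ∑ j ∈ Finset.univ.filter (fun j : Fin N => (j : ℕ) < k), ‖η (Sum.inr j)‖ ^ 2
          ≤ c * ∑ i, ‖η (Sum.inl i)‖ ^ 2
            - quadForm (alg.multiplier N m L (Matrix.diagonal a)) η := by
  induction k with
  | zero =>
    refine ⟨1, zero_le_one, 0, fun _ => le_rfl, fun _ _ => rfl, fun η => ?_⟩
    simp [quadForm_multiplier]
  | succ k ih =>
    obtain ⟨c, hc, a, ha, hak, hca⟩ := ih (by omega)
    obtain ⟨K, hK, hKy⟩ := alg.norm_sq_outputMat_le (N := N) (d := d) k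
    -- The factor `s` makes the previous estimate absorb the term `(L + m)² ‖y_k‖²`.
    let s : ℝ := 1 + (L + m) ^ 2 * K
    have hs : 0 ≤ s := by positivity
    refine ⟨s * c, mul_nonneg hs hc, s • a + Pi.single ⟨k, hk⟩ 1, fun j => ?_, fun j hj => ?_,
      fun η => ?_⟩
    · exact add_nonneg (mul_nonneg hs (ha j))
        ((Pi.single_nonneg.2 zero_le_one : (0 : Fin N → ℝ) ≤ Pi.single ⟨k, hk⟩ 1) j)
    · have hne : j ≠ ⟨k, hk⟩ := fun h => by simp [h] at hj
      simp [hak j (by omega), hne]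
    · have hsum : ∑ j ∈ Finset.univ.filter (fun j : Fin N => (j : ℕ) < k + 1), ‖η (Sum.inr j)‖ ^ 2
          = ∑ j ∈ Finset.univ.filter (fun j : Fin N => (j : ℕ) < k), ‖η (Sum.inr j)‖ ^ 2
            + ‖η (Sum.inr ⟨k, hk⟩)‖ ^ 2 := by
        have : (Finset.univ.filter fun j : Fin N => (j : ℕ) < k + 1)
            = insert ⟨k, hk⟩ (Finset.univ.filter fun j : Fin N => (j : ℕ) < k) := by
          ext j
          simp [Fin.ext_iff]
          omega
        rw [this, Finset.sum_insert (by simp), add_comm]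
      have hdiag : Matrix.diagonal (s • a + Pi.single ⟨k, hk⟩ 1)
          = s • Matrix.diagonal a + Matrix.diagonal (Pi.single (⟨k, hk⟩ : Fin N) (1 : ℝ)) := by
        rw [← Matrix.diagonal_smul, Matrix.diagonal_add]
        rfl
      have hone : quadForm (alg.multiplier N m L
          (Matrix.diagonal (Pi.single (⟨k, hk⟩ : Fin N) (1 : ℝ)))) η
          = 2 * inner ℝ (L • blockMul (alg.outputMat N k) η 0 - η (Sum.inr ⟨k, hk⟩))
            (η (Sum.inr ⟨k, hk⟩) - m • blockMul (alg.outputMat N k) η 0) := by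
        rw [quadForm_multiplier]
        congr 1
        rw [Finset.sum_eq_single ⟨k, hk⟩, Finset.sum_eq_single ⟨k, hk⟩]
        · simp
        · intro j _ hj; simp [Matrix.diagonal_apply_ne' _ hj]
        · simp
        · intro i _ hi
          refine Finset.sum_eq_zero fun j _ => ?_
          simp [Matrix.diagonal_apply, hi]
        · simp
      rw [hsum, hdiag, multiplier_add, multiplier_smul, quadForm_add, quadForm_smul, hone]
      have h1 := mul_le_mul_of_nonneg_left (hca η) hs
      have h2 := norm_sq_sub_le_neg_inner hm hL (blockMul (alg.outputMat N k) η 0)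
        (η (Sum.inr ⟨k, hk⟩))
      have h3 := mul_le_mul_of_nonneg_left (hKy η) (sq_nonneg (L + m))
      simp only [s] at h1 ⊢
      linarith

/-- Some multiplier makes `c R₀ᵀ R₀ - multiplier H` at least the identity. It serves to show that
the program is feasible and to absorb small perturbations at the cost of a slightly larger `b`. -/
theorem exists_coercive_multiplier (hm : 0 ≤ m) (hL : 0 ≤ L) (N : ℕ) :
    ∃ c : ℝ, 0 ≤ c ∧ ∃ H : Matrix (Fin N) (Fin N) ℝ, DoublyHyperdominant H ∧
      (c • ((alg.R₀ N)ᵀ * alg.R₀ N) - alg.multiplier N m L H - 1).PosSemidef := by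
  obtain ⟨c, hc, a, ha, -, hca⟩ := alg.exists_coercive_diagonal (d := 1) hm hL (le_refl N)
  refine ⟨c, hc, Matrix.diagonal a, ⟨fun i j hij => (Matrix.diagonal_apply_ne a hij).le,
    fun i => ?_, fun j => ?_⟩, posSemidef_of_quadForm_nonneg ?_ fun η => ?_⟩
  · simpa [Matrix.diagonal_apply] using ha i
  · simpa [Matrix.diagonal_apply] using ha j
  · simp [transpose_sub, transpose_mul, multiplier_transpose]
  · have := hca η
    rw [quadForm_sub, quadForm_sub, quadForm_smul, quadForm_R₀, quadForm_one,
      Fintype.sum_sum_type]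
    simp only [Fin.is_lt, Finset.filter_true] at this
    linarith

end Algorithm

/-! ### Duality for the semidefinite program -/

namespace DoublyHyperdominant

variable {N : ℕ} {H K : Matrix (Fin N) (Fin N) ℝ}

theorem zero : DoublyHyperdominant (0 : Matrix (Fin N) (Fin N) ℝ) :=
  ⟨fun _ _ _ => le_rfl, fun _ => by simp, fun _ => by simp⟩

theorem add (hH : DoublyHyperdominant H) (hK : DoublyHyperdominant K) :
    DoublyHyperdominant (H + K) :=
  ⟨fun i j hij => add_nonpos (hH.offDiag i j hij) (hK.offDiag i j hij),
    fun i => by simpa [Finset.sum_add_distrib] using add_nonneg (hH.rowSum i) (hK.rowSum i),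
    fun j => by simpa [Finset.sum_add_distrib] using add_nonneg (hH.colSum j) (hK.colSum j)⟩

theorem smul {c : ℝ} (hc : 0 ≤ c) (hH : DoublyHyperdominant H) : DoublyHyperdominant (c • H) :=
  ⟨fun i j hij => mul_nonpos_of_nonneg_of_nonpos hc (hH.offDiag i j hij),
    fun i => by simpa [Finset.mul_sum] using mul_nonneg hc (hH.rowSum i),
    fun j => by simpa [Finset.mul_sum] using mul_nonneg hc (hH.colSum j)⟩

theorem row_eq_zero (hH : DoublyHyperdominant H) {k : Fin N} (hk : H k k = 0) (j : Fin N) :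
    H k j = 0 := by
  have hle : ∀ j ∈ Finset.univ, H k j ≤ 0 := fun j _ => by
    rcases eq_or_ne k j with rfl | h
    · exact hk.le
    · exact hH.offDiag k j h
  exact (Finset.sum_eq_zero_iff_of_nonpos hle).1
    (le_antisymm (Finset.sum_nonpos hle) (hH.rowSum k)) j (Finset.mem_univ j)

theorem transpose (hH : DoublyHyperdominant H) : DoublyHyperdominant Hᵀ :=
  ⟨fun i j hij => hH.offDiag j i hij.symm, hH.colSum, hH.rowSum⟩

theorem col_eq_zero (hH : DoublyHyperdominant H) {k : Fin N} (hk : H k k = 0) (i : Fin N) :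
    H i k = 0 :=
  hH.transpose.row_eq_zero (k := k) hk i

end DoublyHyperdominant

namespace Algorithm

variable {n : ℕ} (alg : Algorithm n) {N d : ℕ} {m L : ℝ}

/-- At the largest `k` with `H k k ≠ 0`, the input `u_k` alone makes the quadratic form of the
multiplier equal to `-2 H k k`, by causality and since later rows and columns of `H` vanish. -/
theorem eq_zero_of_multiplier_eq_zero {H : Matrix (Fin N) (Fin N) ℝ} (hH : DoublyHyperdominant H)
    (h : alg.multiplier N m L H = 0) : H = 0 := by
  suffices hd : ∀ k, H k k = 0 by
    ext k j
    exact hH.row_eq_zero (hd k) j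
  by_contra! hne
  obtain ⟨k₀, hk₀⟩ := hne
  obtain ⟨k, hk, hmax⟩ := Finset.exists_max_image (Finset.univ.filter fun k => H k k ≠ 0) id
    ⟨k₀, by simpa using hk₀⟩
  simp only [Finset.mem_filter, Finset.mem_univ, true_and, id] at hk hmax
  have hgt : ∀ i, k < i → H i i = 0 := fun i hi => by
    by_contra hc
    exact absurd (hmax i hc) (not_le.2 hi)
  let e : Vec 1 := EuclideanSpace.single 0 1
  let η : Fin n ⊕ Fin N → Vec 1 := Pi.single (Sum.inr k) e
  have hy : ∀ i ≤ k, blockMul (alg.outputMat N i) η 0 = 0 := fun i hi => by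
    refine Finset.sum_eq_zero fun j _ => ?_
    rcases eq_or_ne j (Sum.inr k) with rfl | hj
    · rw [alg.outputMat_apply_inr_eq_zero N i k hi, zero_smul]
    · simp [η, hj]
  have hu : ∀ i, i ≠ k → η (Sum.inr i) = 0 := fun i hi => by simp [η, hi]
  have hq := alg.quadForm_multiplier N m L H η
  rw [h, Finset.sum_eq_single k, Finset.sum_eq_single k] at hq
  · rw [hy k le_rfl] at hq
    simp [quadForm, η, e] at hq
    exact hk hq
  · intro j _ hj
    rcases lt_or_ge k j with hkj | hjk
    · rw [hH.col_eq_zero (hgt j hkj), zero_mul]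
    · rw [hy j hjk, hu j hj, smul_zero, sub_zero, inner_zero_right, mul_zero]
  · simp
  · intro i _ hi
    refine Finset.sum_eq_zero fun j _ => ?_
    rcases lt_or_ge k i with hki | hik
    · rw [hH.row_eq_zero (hgt i hki), zero_mul]
    · rw [hy i hik, hu i hi, smul_zero, sub_zero, inner_zero_left, mul_zero]
  · simp

variable (N) in
/-- The pairs `(H, S)` of a doubly hyperdominant `H` and a positive semidefinite `S`, written as
functions of two indices so that they carry the product norm. -/
def certificateCone (n : ℕ) :
    PointedCone ℝ ((Fin N → Fin N → ℝ) × (Fin n ⊕ Fin N → Fin n ⊕ Fin N → ℝ)) where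
  carrier := {p | DoublyHyperdominant (Matrix.of p.1) ∧ (Matrix.of p.2).PosSemidef}
  zero_mem' := ⟨DoublyHyperdominant.zero, PosSemidef.zero⟩
  add_mem' := fun ha hb => ⟨ha.1.add hb.1, ha.2.add hb.2⟩
  smul_mem' := fun t _ ha => ⟨ha.1.smul t.2, ha.2.smul t.2⟩

variable (N m L) in
/-- The map `(H, S) ↦ multiplier H + S`. Its image on `certificateCone` consists of the matrices
whose nonnegativity at all `η` that satisfy the constraints is certified by some multiplier. -/
def certificateMap : ((Fin N → Fin N → ℝ) × (Fin n ⊕ Fin N → Fin n ⊕ Fin N → ℝ)) →ₗ[ℝ]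
    ((Fin n ⊕ Fin N) × (Fin n ⊕ Fin N) → ℝ) where
  toFun p q := alg.multiplier N m L (Matrix.of p.1) q.1 q.2 + p.2 q.1 q.2
  map_add' a b := by
    ext q
    change alg.multiplier N m L (Matrix.of a.1 + Matrix.of b.1) q.1 q.2
        + (a.2 q.1 q.2 + b.2 q.1 q.2)
      = alg.multiplier N m L (Matrix.of a.1) q.1 q.2 + a.2 q.1 q.2
        + (alg.multiplier N m L (Matrix.of b.1) q.1 q.2 + b.2 q.1 q.2)
    rw [multiplier_add, Matrix.add_apply]
    ring
  map_smul' c a := by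
    ext q
    change alg.multiplier N m L (c • Matrix.of a.1) q.1 q.2 + c * a.2 q.1 q.2
      = c * (alg.multiplier N m L (Matrix.of a.1) q.1 q.2 + a.2 q.1 q.2)
    rw [multiplier_smul, Matrix.smul_apply, smul_eq_mul]
    ring

theorem isClosed_certificateCone :
    IsClosed (certificateCone N n :
      Set ((Fin N → Fin N → ℝ) × (Fin n ⊕ Fin N → Fin n ⊕ Fin N → ℝ))) := by
  have h1 : IsClosed {p : (Fin N → Fin N → ℝ) × (Fin n ⊕ Fin N → Fin n ⊕ Fin N → ℝ) |
      (∀ i j, i ≠ j → p.1 i j ≤ 0) ∧ (∀ i, 0 ≤ ∑ j, p.1 i j) ∧ (∀ j, 0 ≤ ∑ i, p.1 i j) ∧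
      (∀ i j, p.2 j i = p.2 i j) ∧
        ∀ v : Fin n ⊕ Fin N → ℝ, 0 ≤ ∑ i, v i * ∑ j, p.2 i j * v j} := by
    simp only [Set.ofPred_and, Set.ofPred_forall]
    refine IsClosed.inter (isClosed_iInter fun i => isClosed_iInter fun j => isClosed_iInter
      fun _ => isClosed_le (by fun_prop) continuous_const) ?_
    refine IsClosed.inter (isClosed_iInter fun i => isClosed_le continuous_const (by fun_prop)) ?_
    refine IsClosed.inter (isClosed_iInter fun i => isClosed_le continuous_const (by fun_prop)) ?_
    refine IsClosed.inter (isClosed_iInter fun i => isClosed_iInter fun j =>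
      isClosed_eq (by fun_prop) (by fun_prop)) ?_
    exact isClosed_iInter fun v => isClosed_le continuous_const (by fun_prop)
  convert h1 using 1
  ext p
  constructor
  · rintro ⟨hH, hS⟩
    exact ⟨hH.offDiag, hH.rowSum, hH.colSum, fun i j => by simpa using hS.1.apply i j,
      fun v => hS.dotProduct_mulVec_nonneg v⟩
  · rintro ⟨h1, h2, h3, h4, h5⟩
    exact ⟨⟨h1, h2, h3⟩, PosSemidef.of_dotProduct_mulVec_nonneg
      (Matrix.IsHermitian.ext fun i j => h4 i j) h5⟩

/-- Strong duality up to closure: a functional separating `X` from the cone of certifiable matrices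
would be pairing with a positive semidefinite matrix, that is, with a Gram matrix of vectors
in `ℝ^d`. -/
theorem mem_closure_of_forall_quadForm_nonneg (hd : N + n ≤ d)
    {X : Matrix (Fin n ⊕ Fin N) (Fin n ⊕ Fin N) ℝ} (hX : Xᵀ = X)
    (h : ∀ η : Fin n ⊕ Fin N → Vec d,
      (∀ H, DoublyHyperdominant H → 0 ≤ quadForm (alg.multiplier N m L H) η) → 0 ≤ quadForm X η) :
    (fun q => X q.1 q.2) ∈ closure
      ((certificateCone N n).map (alg.certificateMap N m L) :
        Set ((Fin n ⊕ Fin N) × (Fin n ⊕ Fin N) → ℝ)) := by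
  by_contra hc
  obtain ⟨l, hl, hlX⟩ := exists_sum_mul_neg_of_notMem_closure hc
  let G : Matrix (Fin n ⊕ Fin N) (Fin n ⊕ Fin N) ℝ := Matrix.of fun i j =>
    (l (i, j) + l (j, i)) / 2
  have hG : G.PosSemidef := by
    refine PosSemidef.of_dotProduct_mulVec_nonneg (Matrix.IsHermitian.ext fun i j => by
      simp [G, add_comm]) fun v => ?_
    -- Test `l` on the rank-one matrix `v vᵀ`.
    have h1 := hl _ ⟨(0, fun i j => v i * v j), ⟨DoublyHyperdominant.zero, by
      simpa [vecMulVec] using posSemidef_vecMulVec_self_star v⟩, rfl⟩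
    have h0 : alg.multiplier N m L (Matrix.of 0) = 0 := by
      have := alg.multiplier_smul N m L 0 0
      rwa [zero_smul, zero_smul] at this
    simp only [certificateMap, LinearMap.coe_restrictScalars, LinearMap.coe_mk, AddHom.coe_mk,
      h0, Matrix.zero_apply, zero_add, Fintype.sum_prod_type] at h1
    have h2 := h1
    rw [Finset.sum_comm] at h2
    have h3 : ∀ i j, v i * (G i j * v j)
        = (l (i, j) * (v i * v j)) / 2 + (l (j, i) * (v j * v i)) / 2 := fun i j => by
      simp only [G, of_apply]; ring
    simp only [dotProduct, mulVec, star_trivial, Finset.mul_sum, h3, Finset.sum_add_distrib,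
      ← Finset.sum_div]
    linarith
  obtain ⟨η, hη⟩ := exists_inner_eq_of_posSemidef hG (d := d) (by simpa [add_comm] using hd)
  have h1 := h η fun H hH => by
    rw [quadForm_eq_sum_mul (alg.multiplier_transpose N m L H) l hη]
    have := hl _ ⟨(H, 0), ⟨hH, PosSemidef.zero⟩, rfl⟩
    simp [certificateMap] at this
    exact this
  rw [quadForm_eq_sum_mul hX l hη] at h1
  exact absurd hlX (not_lt.2 h1)

/-- Under the rank assumption the cone of certifiable matrices is closed: pairing `multiplier H + S`
with the Gram matrix of a linearly independent `η` that satisfies the constraints shows that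
`multiplier H + S = 0` forces `S = 0`, and then `H = 0`. -/
theorem isClosed_map_certificateCone (hrank : alg.RankAssumption d N m L) :
    IsClosed ((certificateCone N n).map (alg.certificateMap N m L) :
        Set ((Fin n ⊕ Fin N) × (Fin n ⊕ Fin N) → ℝ)) := by
  obtain ⟨η, hη, hr⟩ := hrank
  have hli := linearIndependent_of_card_le_rank (η := η) (by simpa [add_comm] using hr)
  refine isClosed_map_of_forall_eq_zero (alg.certificateMap N m L) isClosed_certificateCone
    (fun x hx t ht => (certificateCone N n).smul_mem ht hx) ?_
  rintro ⟨H, S⟩ ⟨hH, hS⟩ h0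
  have hsum : alg.multiplier N m L (Matrix.of H) + Matrix.of S = 0 := by
    ext i j
    exact congrFun h0 (i, j)
  have hmul : 0 ≤ quadForm (alg.multiplier N m L (Matrix.of H)) η := by
    obtain ⟨c, hc, he⟩ := hH.exists_eq_sum_Qmat
    have hlin : alg.multiplier N m L (Matrix.of H)
        = ∑ π, (2 * c π) • alg.cycMat N m L π := by
      let φ : Matrix (Fin N) (Fin N) ℝ →+ Matrix (Fin n ⊕ Fin N) (Fin n ⊕ Fin N) ℝ :=
        AddMonoidHom.mk' (alg.multiplier N m L) (alg.multiplier_add N m L)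
      change φ (Matrix.of H) = _
      rw [he, map_sum]
      refine Finset.sum_congr rfl fun π _ => ?_
      change alg.multiplier N m L (c π • Qmat π) = _
      rw [multiplier_smul, cycMat, smul_smul]
      congr 1
      ring
    rw [hlin, quadForm_sum]
    exact Finset.sum_nonneg fun π _ => by
      rw [quadForm_smul]
      exact mul_nonneg (mul_nonneg zero_le_two (hc π)) (hη π)
  have hSn := quadForm_nonneg hS η
  have hq : quadForm (alg.multiplier N m L (Matrix.of H)) η + quadForm (Matrix.of S) η = 0 := by
    rw [← quadForm_add, hsum]
    simp [quadForm]
  -- Both summands of `hq` are nonnegative, so both vanish.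
  have hS0 : Matrix.of S = 0 := eq_zero_of_quadForm_eq_zero hS hli (by linarith)
  rw [hS0, add_zero] at hsum
  have hH0 := alg.eq_zero_of_multiplier_eq_zero hH hsum
  exact Prod.ext hH0 hS0

/-- If `M₀ b` is a limit of certifiable matrices, then the program takes values arbitrarily close
to `b`: the error is at most a small multiple of the identity, which a multiple of the coercive
multiplier absorbs. -/
theorem exists_mem_sdpFeasible_le (hm : 0 ≤ m) (hL : 0 ≤ L) {b : ℝ} (hb : 0 ≤ b)
    (hmem : (fun q => alg.M₀ N b q.1 q.2) ∈ closure
      ((certificateCone N n).map (alg.certificateMap N m L) :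
        Set ((Fin n ⊕ Fin N) × (Fin n ⊕ Fin N) → ℝ))) {ε : ℝ} (hε : 0 < ε) :
    ∃ b' ∈ alg.sdpFeasible N m L, b' ≤ b + ε := by
  obtain ⟨c, hc, H₁, hH₁, hpsd⟩ := alg.exists_coercive_multiplier hm hL N
  -- `√(b² + δ c) ≤ b + ε`, and an entrywise error `τ` is at most `δ` as a quadratic form.
  let δ : ℝ := ε ^ 2 / (c + 1)
  have hδ : 0 < δ := by positivity
  have hδc : δ * c ≤ ε ^ 2 := by
    rw [div_mul_eq_mul_div, div_le_iff₀ (by positivity)]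
    nlinarith [sq_nonneg ε]
  let τ : ℝ := δ / (Fintype.card (Fin n ⊕ Fin N) + 1)
  have hτ : 0 < τ := by positivity
  have hτδ : τ * Fintype.card (Fin n ⊕ Fin N) ≤ δ := by
    rw [div_mul_eq_mul_div, div_le_iff₀ (by positivity)]
    nlinarith
  obtain ⟨_, ⟨⟨H, S⟩, ⟨hH, hS⟩, rfl⟩, hdist⟩ := Metric.mem_closure_iff.1 hmem τ hτ
  let X := alg.M₀ N b - alg.multiplier N m L (Matrix.of H) - Matrix.of S
  have hX : ∀ i j, |X i j| ≤ τ := fun i j => by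
    have h1 := (dist_le_pi_dist _ _ (i, j)).trans hdist.le
    rw [Real.dist_eq] at h1
    refine le_trans (le_of_eq ?_) h1
    congr 1
    change alg.M₀ N b i j - alg.multiplier N m L (Matrix.of H) i j - S i j
      = alg.M₀ N b i j - (alg.multiplier N m L (Matrix.of H) i j + S i j)
    ring
  have hST : (Matrix.of S)ᵀ = Matrix.of S := by
    simpa [IsHermitian] using hS.1
  have hXδ : (X + δ • 1).PosSemidef := by
    refine posSemidef_of_quadForm_nonneg ?_ fun η => ?_
    · simp [X, transpose_add, transpose_sub, M₀_transpose, multiplier_transpose, hST]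
    · have h1 := neg_mul_le_quadForm hX η
      rw [quadForm_add, quadForm_smul, quadForm_one]
      have := mul_le_mul_of_nonneg_right hτδ
        (Finset.sum_nonneg fun i (_ : i ∈ Finset.univ) => sq_nonneg ‖η i‖)
      linarith
  refine ⟨√(b ^ 2 + δ * c), ⟨Real.sqrt_nonneg _, Matrix.of H + δ • H₁,
    hH.add (hH₁.smul hδ.le), ?_⟩, ?_⟩
  · have he : alg.M₀ N √(b ^ 2 + δ * c) - alg.multiplier N m L (Matrix.of H + δ • H₁)
        = (Matrix.of S + (X + δ • 1))
          + δ • (c • ((alg.R₀ N)ᵀ * alg.R₀ N) - alg.multiplier N m L H₁ - 1) := by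
      simp only [X, multiplier_add, multiplier_smul, M₀]
      rw [Real.sq_sqrt (by positivity)]
      module
    rw [he]
    exact (hS.add hXδ).add (hpsd.smul hδ.le)
  · rw [Real.sqrt_le_left (by positivity)]
    nlinarith [mul_nonneg hb hε.le]

theorem sdpFeasible_nonempty (hm : 0 ≤ m) (hL : 0 ≤ L) : (alg.sdpFeasible N m L).Nonempty := by
  obtain ⟨c, hc, H, hH, hpsd⟩ := alg.exists_coercive_multiplier hm hL N
  obtain ⟨K, hK, hKy⟩ := alg.norm_sq_outputMat_le (N := N) (d := 1) N
  refine ⟨√(K * c), Real.sqrt_nonneg _, K • H, hH.smul hK,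
    posSemidef_of_quadForm_nonneg ?_ fun η => ?_⟩
  · simp [transpose_sub, M₀_transpose, multiplier_transpose]
  · have h1 := mul_le_mul_of_nonneg_left (quadForm_nonneg hpsd η) hK
    have h2 := hKy η
    rw [quadForm_sub, quadForm_sub, quadForm_smul, quadForm_R₀, quadForm_one,
      Fintype.sum_sum_type] at h1
    simp only [Fin.is_lt, Finset.filter_true] at h2
    rw [quadForm_sub, quadForm_M₀, multiplier_smul, quadForm_smul, Real.sq_sqrt (by positivity)]
    linarith

end Algorithm

end WorstCase

end

theorem theorem1 (n N d : ℕ) (hn : 0 < n) (hd : N + n ≤ d) (m L : ℝ) (hm : 0 < m) (hmL : m < L)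
    (alg : WorstCase.Algorithm n) :
    ∃ b : ℝ, alg.IsWorstCaseBound d N m L b ∧
      IsGLB (alg.sdpFeasible N m L) b ∧
      (alg.RankAssumption d N m L → IsLeast (alg.sdpFeasible N m L) b) := by
  have hL : 0 ≤ L := (hm.trans hmL).le
  have hfb : ∀ b ∈ alg.sdpFeasible N m L, alg.IsBound d N m L b :=
    fun b => alg.isBound_of_mem_sdpFeasible hmL
  have hbdd : BddBelow {b : ℝ | alg.IsBound d N m L b} :=
    ⟨0, fun b => alg.nonneg_of_isBound hn (by omega) hm.le hmL⟩
  have hleast : IsLeast {b : ℝ | alg.IsBound d N m L b} (sInf {b : ℝ | alg.IsBound d N m L b}) :=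
    alg.isClosed_setOf_isBound.isLeast_csInf
      ((alg.sdpFeasible_nonempty (N := N) hm.le hL).mono hfb) hbdd
  have hb0 := alg.nonneg_of_isBound hn (by omega) hm.le hmL hleast.1
  have hmem := alg.mem_closure_of_forall_quadForm_nonneg (m := m) (L := L) hd
    (alg.M₀_transpose N _) (alg.quadForm_M₀_nonneg_of_isBound hm.le hmL hleast.1)
  refine ⟨_, hleast, ⟨fun b hb => hleast.2 (hfb b hb), fun a ha => ?_⟩, fun hrank => ?_⟩
  · refine le_of_forall_pos_le_add fun ε hε => ?_
    obtain ⟨b', hb', hle⟩ := alg.exists_mem_sdpFeasible_le hm.le hL hb0 hmem hε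
    exact (ha hb').trans hle
  · rw [(alg.isClosed_map_certificateCone hrank).closure_eq] at hmem
    obtain ⟨⟨H, S⟩, ⟨hH, hS⟩, he⟩ := hmem
    refine ⟨⟨hb0, Matrix.of H, hH, ?_⟩, fun b hb => hleast.2 (hfb b hb)⟩
    convert hS using 1
    ext i j
    have : alg.multiplier N m L (Matrix.of H) i j + S i j = alg.M₀ N _ i j := congrFun he (i, j)
    simp [← this]
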